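/- **Setting.** Let $\mathbb T^3=\mathbb R^3/\mathbb Z^3$ (total mass $1$), $\epsilon_0\in(0,1)$ and $m\ge 1$. Let $B_1,\dots,B_m$ be open balls contained in $\{\xi\in\mathbb R^3: 1<|\xi|<1+\epsilon_0/2\}$ such that $B_1,\dots,B_m,-B_1,\dots,-B_m$ are pairwise disjoint. Let $\psi_1,\dots,\psi_m:\mathbb R^3\to\mathbb R^3$ be divergence-free Schwartz vector fields with Fourier transform (normalized by $e^{-2\pi i x\cdot\xi}$) supported on $B_i\cup -B_i$ and $\|\psi_i\|_{L^2(\mathbb R^3)}=1$. For $n\in\mathbb Z$ put $$\psi_{i,n}(x)=(1+\epsilon_0)^{3n/2}\psi_i((1+\epsilon_0)^n x),\qquad \psi^{\rm per}_{i,n}(x)=\sum_{l\in\mathbb Z^3}\psi_{i,n}(x+l),\qquad \tilde\psi^{\rm per}_{i,n}=\frac{\psi^{\rm per}_{i,n}}{\|\psi^{\rm per}_{i,n}\|_{L^2(\mathbb T^3)}},$$ with the convention $\tilde\psi^{\rm per}_{i,n}:=0$ if $\psi^{\rm per}_{i,n}=0$. Let $S=\{(0,0,0),(1,0,0),(0,1,0),(0,0,1)\}$,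 let $\alpha_{i_1,i_2,i_3,\mu}\in\mathbb R$ ($1\le i_1,i_2,i_3\le m$, $\mu\in S$) be arbitrary structure constants, and let $$C(u,v)=\sum_{n\in\mathbb Z}\sum_{i_1,i_2,i_3=1}^m\sum_{\mu\in S}\alpha_{i_1,i_2,i_3,\mu}(1+\epsilon_0)^{5n/2}\langle u,\tilde\psi^{\rm per}_{i_1,n+\mu_1}\rangle_{L^2(\mathbb T^3)}\langle v,\tilde\psi^{\rm per}_{i_2,n+\mu_2}\rangle_{L^2(\mathbb T^3)}\tilde\psi^{\rm per}_{i_3,n+\mu_3}.$$ A global mild solution in $H^{10}_{\rm df}(\mathbb T^3)$ (the real divergence-free vector fields in $H^{10}(\mathbb T^3)$) of $\partial_t u=\Delta u+C(u,u)$, $u(0)=\tilde\psi^{\rm per}_{1,n_0}$, is a continuous map $u:[0,\infty)\to H^{10}_{\rm df}(\mathbb T^3)$ with $$u(t)=e^{t\Delta}\tilde\psi^{\rm per}_{1,n_0}+\int_0^t e^{(t-s)\Delta}C(u(s),u(s))\,ds\qquad(t\ge 0).$$ For such $u$ let $u_{i,n}(t)$ be the part of $u(t)$ with frequencies in $\mathbb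 Z^3\cap(1+\epsilon_0)^n(B_i\cup -B_i)$, and let $$X_{i,n}(t)=\langle u(t),\tilde\psi^{\rm per}_{i,n}\rangle_{L^2(\mathbb T^3)},\qquad E_{i,n}(t)=\tfrac12\|u_{i,n}(t)\|_{L^2(\mathbb T^3)}^2,$$ $$Q_{i,n}=\sum_{i_1,i_2=1}^m\sum_{\mu\in S}\alpha_{i_1,i_2,i,\mu}(1+\epsilon_0)^{5(n-\mu_3)/2}X_{i_1,n-\mu_3+\mu_1}X_{i_2,n-\mu_3+\mu_2}.$$ **Lemma.** There is an absolute constant $K>0$ such that for all $\epsilon_0,m,(B_i),(\psi_i)$ as above there is an $N\in\mathbb N$ with $\psi^{\rm per}_{i,n}\ne 0$ for all $1\le i\le m$ and $n\ge N$, and such that for all structure constants $\alpha$, all integers $n_0\ge N$ and every global mild solution $u$ in $H^{10}_{\rm df}(\mathbb T^3)$ with $u(0)=\tilde\psi^{\rm per}_{1,n_0}$ the following holds for all $n\in\mathbb Z$, $1\le i\le m$ and $t\ge0$. 1. For every $T\in(0,\infty)$, $$\sup_{t\in[0,T]}\sup_{n\in\mathbb Z}\sup_{1\le i\le m}(1+(1+\epsilon_0)^{10n})|X_{i,n}(t)|<\infty,\qquad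 \sup_{t\in[0,T]}\sup_{n\in\mathbb Z}\sup_{1\le i\le m}(1+(1+\epsilon_0)^{10n})|E_{i,n}(t)|<\infty.$$ 2. $E_{i,n}(0)=\frac12X_{i,n}(0)^2$, and $X_{i,n}(0)=1$ if $(i,n)=(1,n_0)$ and $X_{i,n}(0)=0$ otherwise. 3. $X_{i,n}$ and $E_{i,n}$ are differentiable on $[0,\infty)$ (one-sidedly at $0$), and $$\left|\partial_tX_{i,n}(t)-Q_{i,n}(t)\right|\le K(1+\epsilon_0)^{2n}\sqrt{E_{i,n}(t)},\qquad \partial_tE_{i,n}(t)\le Q_{i,n}(t)X_{i,n}(t).$$ 4. $\frac12X_{i,n}(t)^2\le E_{i,n}(t)\le\frac12X_{i,n}(t)^2+K(1+\epsilon_0)^{2n}\int_0^tE_{i,n}(s)\,ds$. 5. If $n<n_0$, then $X_{i,n}(t)=0=E_{i,n}(t)$. -/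

import Mathlib

open MeasureTheory Filter Topology Set
open scoped SchwartzMap FourierTransform Pointwise

noncomputable section

namespace CascadeTorus

/-! ### Vector fields on the torus -/

/-- Euclidean space `ℝ³`. -/
abbrev E3 : Type := EuclideanSpace ℝ (Fin 3)

/-- The torus `𝕋³ = ℝ³ / ℤ³`. -/
abbrev T3 : Type := UnitAddTorus (Fin 3)

/-- Lebesgue measure on `𝕋³`, of total mass one. -/
abbrev torusMeasure : Measure T3 :=
  Measure.pi fun _ : Fin 3 => (AddCircle.haarAddCircle : Measure UnitAddCircle)

/-- The real Hilbert space `L²(𝕋³; ℝ³)`. -/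
abbrev L2T : Type := Lp E3 2 torusMeasure

/-- A lattice point of `ℤ³` as a point of `ℝ³`. -/
def lat (k : Fin 3 → ℤ) : E3 := WithLp.toLp 2 fun j => (k j : ℝ)

/-- The `j`-th component of the Fourier coefficient at `k`, that is
`∫ f_j(y) exp (-2πi k·y) dy` over the torus. -/
def fcoeff (f : L2T) (k : Fin 3 → ℤ) (j : Fin 3) : ℂ :=
  UnitAddTorus.mFourierCoeff (fun y : T3 => ((f y j : ℝ) : ℂ)) k

/-- The vector field `y ↦ Re (f̂(k) exp (2πi k·y))`. -/
def fmode (f : L2T) (k : Fin 3 → ℤ) : L2T :=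
  ContinuousMap.toLp (E := E3) 2 torusMeasure ℝ
    ⟨fun y => WithLp.toLp 2 fun j => (fcoeff f k j * UnitAddTorus.mFourier k y).re, by fun_prop⟩

/-- The Fourier multiplier with a real, bounded and even symbol `σ`: since `f` is real,
`∑ₖ σ(k) f̂(k) exp (2πi k·y) = ∑ₖ σ(k) Re (f̂(k) exp (2πi k·y))`; the sum converges in `L²`. -/
def fourierMultiplier (σ : (Fin 3 → ℤ) → ℝ) (f : L2T) : L2T :=
  ∑' k : Fin 3 → ℤ, σ k • fmode f k

/-- The heat semigroup `exp (tΔ)` (used for `t ≥ 0` only). -/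
def heat (t : ℝ) (f : L2T) : L2T :=
  fourierMultiplier (fun k => Real.exp (-(4 * Real.pi ^ 2 * ‖lat k‖ ^ 2 * t))) f

/-- The summands of the squared `Hˢ` norm. -/
def sobolevTerm (s : ℝ) (f : L2T) (k : Fin 3 → ℤ) : ℝ :=
  (1 + 4 * Real.pi ^ 2 * ‖lat k‖ ^ 2) ^ s * ∑ j, ‖fcoeff f k j‖ ^ 2

/-- The norm of `Hˢ(𝕋³)`, that is the `L²` norm of `(Id - Δ)^(s/2) f`. -/
def sobolevNorm (s : ℝ) (f : L2T) : ℝ := √(∑' k, sobolevTerm s f k)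

/-- `f` belongs to `Hˢ(𝕋³)` (for `s ≥ 0`) and is divergence-free (as a distribution). -/
def MemHdf (s : ℝ) (f : L2T) : Prop :=
  Summable (sobolevTerm s f) ∧ ∀ k : Fin 3 → ℤ, ∑ j, (k j : ℂ) * fcoeff f k j = 0

/-! ### Periodization -/

/-- The representative in `[0,1)³` of a point of the torus. -/
def rep (y : T3) : E3 := WithLp.toLp 2 fun j => ((AddCircle.equivIco (1 : ℝ) 0 (y j) : ℝ))

/-- The periodization `∑_{l ∈ ℤ³} g (x + l)` as a function on the torus. -/
def periodize (g : E3 → E3) (y : T3) : E3 := ∑' l : Fin 3 → ℤ, g (rep y + lat l)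

/-- The rescaling `a ^ (3n/2) ψ (a ^ n ·)`. -/
def dilate (a : ℝ) (n : ℤ) (ψ : E3 → E3) (x : E3) : E3 :=
  a ^ (3 * (n : ℝ) / 2) • ψ (a ^ n • x)

lemma measurable_rep : Measurable rep := by
  refine (MeasurableEquiv.toLp 2 (Fin 3 → ℝ)).measurable.comp ?_
  exact measurable_pi_lambda _ fun j => measurable_subtype_coe.comp
    ((AddCircle.measurableEquivIco (1 : ℝ) 0).measurable.comp (measurable_pi_apply j))

lemma norm_rep_le (y : T3) : ‖rep y‖ ≤ 2 := by
  have h : ∀ j, (rep y j) ^ 2 ≤ 1 := fun j => by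
    have := (AddCircle.equivIco (1 : ℝ) 0 (y j)).2
    simp only [rep, Set.mem_Ico] at this ⊢
    nlinarith
  rw [EuclideanSpace.norm_eq, Real.sqrt_le_left (by norm_num)]
  simp only [Fin.sum_univ_three, Real.norm_eq_abs, sq_abs]
  linarith [h 0, h 1, h 2]

lemma summable_lat : Summable fun l : Fin 3 → ℤ => ((1 + ‖lat l‖) ^ 6)⁻¹ := by
  have h1 : Summable fun a : ℤ => ((1 + |(a : ℝ)|) ^ 2)⁻¹ := by
    have h0 : Summable fun n : ℕ => ((1 + |(n : ℝ)|) ^ 2)⁻¹ := by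
      have := (summable_nat_add_iff 1).2 (Real.summable_nat_pow_inv.2 (le_refl 2))
      refine this.congr fun n => ?_
      rw [Nat.abs_cast]; push_cast; ring
    refine Summable.of_nat_of_neg ?_ ?_
    · simpa using h0
    · simpa using h0
  have h3 := h1.mul_of_nonneg (h1.mul_of_nonneg h1 (fun _ => by positivity)
    (fun _ => by positivity)) (fun _ => by positivity) (fun _ => by positivity)
  let e : (Fin 3 → ℤ) ≃ ℤ × ℤ × ℤ :=
    { toFun := fun v => (v 0, v 1, v 2)
      invFun := fun p => ![p.1, p.2.1, p.2.2]
      left_inv := fun v => by ext j; fin_cases j <;> rfl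
      right_inv := fun p => rfl }
  refine Summable.of_nonneg_of_le (fun _ => by positivity) (fun l => ?_) (e.summable_iff.2 h3)
  have hj : ∀ j, |(l j : ℝ)| ≤ ‖lat l‖ := fun j => PiLp.norm_apply_le (lat l) j
  simp only [Function.comp, e, ← mul_inv]
  refine inv_anti₀ (by positivity) ?_
  calc _ ≤ (1 + ‖lat l‖) ^ 2 * ((1 + ‖lat l‖) ^ 2 * (1 + ‖lat l‖) ^ 2) := by
        gcongr <;> exact hj _
    _ = _ := by ring

/-- The periodization of a continuous, rapidly decaying vector field is square-integrable. -/
lemma memLp_periodize {g : E3 → E3} (hg : Continuous g) {C : ℝ}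
    (hC : ∀ x, (1 + ‖x‖) ^ 6 * ‖g x‖ ≤ C) : MemLp (periodize g) 2 torusMeasure := by
  have hC0 : 0 ≤ C := le_trans (by positivity) (hC 0)
  have hb : ∀ y l, ‖g (rep y + lat l)‖ ≤ 3 ^ 6 * C * ((1 + ‖lat l‖) ^ 6)⁻¹ := fun y l => by
    have h1 : 1 + ‖lat l‖ ≤ 3 * (1 + ‖rep y + lat l‖) := by
      have := norm_sub_le (rep y + lat l) (rep y)
      rw [add_sub_cancel_left] at this
      linarith [norm_rep_le y, norm_nonneg (rep y + lat l)]
    rw [← div_eq_mul_inv, le_div_iff₀ (by positivity), mul_comm]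
    calc _ ≤ (3 * (1 + ‖rep y + lat l‖)) ^ 6 * ‖g (rep y + lat l)‖ := by gcongr
      _ = 3 ^ 6 * ((1 + ‖rep y + lat l‖) ^ 6 * ‖g (rep y + lat l)‖) := by ring
      _ ≤ _ := by gcongr; exact hC _
  have hs := summable_lat.mul_left (3 ^ 6 * C)
  refine MemLp.of_bound (Measurable.aestronglyMeasurable ?_)
    (∑' l, 3 ^ 6 * C * ((1 + ‖lat l‖) ^ 6)⁻¹) (ae_of_all _ fun y => ?_)
  · exact Measurable.tsum fun l =>
      hg.measurable.comp (measurable_rep.add_const _)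
  · exact tsum_of_norm_bounded hs.hasSum (hb y)

lemma dilate_decay {a : ℝ} (ha : 0 < a) (n : ℤ) (ψ : 𝓢(E3, E3)) :
    ∃ C, ∀ x, (1 + ‖x‖) ^ 6 * ‖dilate a n ψ x‖ ≤ C := by
  set b : ℝ := a ^ n with hb
  have hb0 : 0 < b := zpow_pos ha n
  obtain ⟨M, hM⟩ : ∃ M, ∀ x, (1 + ‖x‖) ^ 6 * ‖ψ x‖ ≤ M :=
    ⟨_, fun x => by
      simpa using SchwartzMap.one_add_le_sup_seminorm_apply (𝕜 := ℝ) (m := (6, 0)) le_rfl le_rfl ψ x⟩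
  refine ⟨(1 + b⁻¹) ^ 6 * |a ^ (3 * (n : ℝ) / 2)| * M, fun x => ?_⟩
  have h1 : 1 + ‖x‖ ≤ (1 + b⁻¹) * (1 + ‖b • x‖) := by
    rw [norm_smul, Real.norm_of_nonneg hb0.le]
    have : b⁻¹ * (b * ‖x‖) = ‖x‖ := by field_simp
    have h2 : 0 < b⁻¹ := by positivity
    have h3 : 0 ≤ b * ‖x‖ := by positivity
    nlinarith
  calc _ = (1 + ‖x‖) ^ 6 * (|a ^ (3 * (n : ℝ) / 2)| * ‖ψ (b • x)‖) := by
        rw [dilate, norm_smul, Real.norm_eq_abs]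
    _ ≤ ((1 + b⁻¹) * (1 + ‖b • x‖)) ^ 6 * (|a ^ (3 * (n : ℝ) / 2)| * ‖ψ (b • x)‖) := by gcongr
    _ = (1 + b⁻¹) ^ 6 * |a ^ (3 * (n : ℝ) / 2)| * ((1 + ‖b • x‖) ^ 6 * ‖ψ (b • x)‖) := by ring
    _ ≤ _ := by gcongr; exact hM _

lemma memLp_periodize_dilate {a : ℝ} (ha : 0 < a) (n : ℤ) (ψ : 𝓢(E3, E3)) :
    MemLp (periodize (dilate a n ψ)) 2 torusMeasure := by
  obtain ⟨C, hC⟩ := dilate_decay ha n ψ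
  refine memLp_periodize ?_ hC
  exact (ψ.continuous.comp (continuous_const_smul (a ^ n))).const_smul (a ^ (3 * (n : ℝ) / 2))

/-! ### The periodized local cascade operator -/

/-- The profiles entering a local cascade operator with parameters `ε₀ ∈ (0,1)` and `m`: balls
`B i` in the annulus `1 < |ξ| < 1 + ε₀ / 2` such that all the `B i` and `-B j` are disjoint, and
divergence-free real Schwartz vector fields `ψ i` on `ℝ³` with Fourier transform supported on
`B i ∪ -B i` and with `L²` norm one. -/
structure CascadeProfile (ε₀ : ℝ) (m : ℕ) where
  eps_pos : 0 < ε₀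
  eps_lt_one : ε₀ < 1
  center : Fin m → E3
  radius : Fin m → ℝ
  radius_pos : ∀ i, 0 < radius i
  ball_subset : ∀ i, Metric.ball (center i) (radius i) ⊆ {ξ | 1 < ‖ξ‖ ∧ ‖ξ‖ < 1 + ε₀ / 2}
  ball_disjoint : ∀ i j, i ≠ j →
    Disjoint (Metric.ball (center i) (radius i)) (Metric.ball (center j) (radius j))
  ball_neg_disjoint : ∀ i j,
    Disjoint (Metric.ball (center i) (radius i)) (-Metric.ball (center j) (radius j))
  ψ : Fin m → 𝓢(E3, E3)
  div_free : ∀ i x, ∑ j, (fderiv ℝ (ψ i) x (EuclideanSpace.single j 1)) j = 0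
  fourier_support : ∀ i ξ,
    ξ ∉ Metric.ball (center i) (radius i) ∪ -Metric.ball (center i) (radius i) →
    ∀ j, 𝓕 (fun x : E3 => ((ψ i x j : ℝ) : ℂ)) ξ = 0
  norm_one : ∀ i, ∫ x, ‖ψ i x‖ ^ 2 = 1

/-- The index set `S` of the frequency shifts `(μ₁, μ₂, μ₃)`. -/
def shifts : Finset (ℤ × ℤ × ℤ) := {(0, 0, 0), (1, 0, 0), (0, 1, 0), (0, 0, 1)}

namespace CascadeProfile

variable {ε₀ : ℝ} {m : ℕ} (D : CascadeProfile ε₀ m)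

/-- The periodization of `ψ_{i,n} = (1 + ε₀) ^ (3n/2) ψ_i ((1 + ε₀) ^ n ·)`. -/
def psiPer (i : Fin m) (n : ℤ) : L2T :=
  (memLp_periodize_dilate (a := 1 + ε₀) (by linarith [D.eps_pos]) n (D.ψ i)).toLp
    (periodize (dilate (1 + ε₀) n (D.ψ i)))

/-- The `L²`-normalized periodization; it is `0` in case the periodization vanishes identically. -/
def psiNorm (i : Fin m) (n : ℤ) : L2T := ‖D.psiPer i n‖⁻¹ • D.psiPer i n

/-- The periodized local cascade operator with structure constants `α`. For `u, v` in
`H¹⁰(𝕋³)` the series converges absolutely in `L²(𝕋³)`. -/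
def cascade (α : Fin m → Fin m → Fin m → ℤ × ℤ × ℤ → ℝ) (u v : L2T) : L2T :=
  ∑' n : ℤ, ∑ i₁, ∑ i₂, ∑ i₃, ∑ μ ∈ shifts,
    (α i₁ i₂ i₃ μ * (1 + ε₀) ^ (5 * (n : ℝ) / 2) * inner ℝ u (D.psiNorm i₁ (n + μ.1)) *
      inner ℝ v (D.psiNorm i₂ (n + μ.2.1))) • D.psiNorm i₃ (n + μ.2.2)

/-- `u : [0,∞) → H¹⁰_df(𝕋³)` is a global mild solution of `∂ₜu = Δu + C(u,u)`, `u(0) = u₀`: it is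
continuous in the `H¹⁰` norm and satisfies Duhamel's formula. (The values of `u` at negative times
play no role.) -/
structure IsMildSolution (α : Fin m → Fin m → Fin m → ℤ × ℤ × ℤ → ℝ) (u₀ : L2T)
    (u : ℝ → L2T) : Prop where
  mem : ∀ t, 0 ≤ t → MemHdf 10 (u t)
  continuous : ∀ t, 0 ≤ t → Tendsto (fun s => sobolevNorm 10 (u s - u t)) (𝓝[Ici 0] t) (𝓝 0)
  integrable : ∀ t, 0 ≤ t →
    IntervalIntegrable (fun s => heat (t - s) (D.cascade α (u s) (u s))) volume 0 t
  duhamel : ∀ t, 0 ≤ t →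
    u t = heat t u₀ + ∫ s in (0 : ℝ)..t, heat (t - s) (D.cascade α (u s) (u s))

/-- The frequency region `(1 + ε₀) ^ n (B i ∪ -B i)`. -/
def region (i : Fin m) (n : ℤ) : Set E3 :=
  (1 + ε₀) ^ n •
    (Metric.ball (D.center i) (D.radius i) ∪ -Metric.ball (D.center i) (D.radius i))

open Classical in
/-- The part `f_{i,n}` of `f` with frequencies in `ℤ³ ∩ (1 + ε₀) ^ n (B i ∪ -B i)`. -/
def localize (i : Fin m) (n : ℤ) (f : L2T) : L2T :=
  fourierMultiplier (fun k => if lat k ∈ D.region i n then 1 else 0) f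

/-- The coefficient `X_{i,n}(t)` of `u`. -/
def X (u : ℝ → L2T) (i : Fin m) (n : ℤ) (t : ℝ) : ℝ := inner ℝ (u t) (D.psiNorm i n)

/-- The local energy `E_{i,n}(t)` of `u`. -/
def E (u : ℝ → L2T) (i : Fin m) (n : ℤ) (t : ℝ) : ℝ := 1 / 2 * ‖D.localize i n (u t)‖ ^ 2

/-- The quadratic interaction term
`∑_{i₁,i₂} ∑_μ α_{i₁,i₂,i,μ} (1+ε₀)^(5(n-μ₃)/2) X_{i₁,n-μ₃+μ₁} X_{i₂,n-μ₃+μ₂}`. -/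
def interaction (α : Fin m → Fin m → Fin m → ℤ × ℤ × ℤ → ℝ) (u : ℝ → L2T) (i : Fin m) (n : ℤ)
    (t : ℝ) : ℝ :=
  ∑ i₁, ∑ i₂, ∑ μ ∈ shifts, α i₁ i₂ i μ * (1 + ε₀) ^ (5 * ((n - μ.2.2 : ℤ) : ℝ) / 2) *
    D.X u i₁ (n - μ.2.2 + μ.1) t * D.X u i₂ (n - μ.2.2 + μ.2.1) t

end CascadeProfile

end CascadeTorus

end

noncomputable section

namespace CascadeTorus

/-! ### Fourier coefficients of real vector fields on the torus -/

/-! The regions `(1+ε₀)^n (B i ∪ -B i)` are pairwise disjoint over all pairs `(i, n)`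
(`region_injective`), and each contains finitely many lattice points. By Poisson summation
(`fcoeff_periodize`), the normalized periodized profile of index `(i, n)` has its frequencies in the
region of that index. On that region the Fourier coefficients of `C(u,u)` are therefore the scalar
`Q_{i,n}` times those of the profile (`fcoeff_cascade`), and Duhamel's formula becomes a linear ODE
at each frequency (`hasDerivWithinAt_fcoeff`).

Finite sums of these ODEs give `X' = -drift + Q‖ψ̃‖²` and `E' = -dissipation + Q X`. The dissipation
is nonnegative. Since `|k| ≤ (3/2)(1+ε₀)^n` on the region, Cauchy–Schwarz bounds the drift by a
multiple of `(1+ε₀)^(2n) √E` (`abs_drift_le`). Where `‖ψ̃‖ = 1`, the `Q` terms cancel in the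
derivative of `E - X²/2`, so that only `X · drift = O((1+ε₀)^(2n) E)` has to be integrated (`E_le`).

Scales below `n₀` stay empty by induction on `n` (`E_eq_zero`): for `n < 0` there are no lattice
points in the region, and if scale `n - 1` is empty, every term of `Q_{i,n} X_{i,n}` that remains
contains two coefficients of scale `n`, so Gronwall applies to the total energy of scale `n`. The
weighted bounds compare the region's frequencies with the `H¹⁰` weight
(`weight_mul_norm_localize_le`). -/

/-- The `j`-th component of a vector field as a complex-valued function. -/
def component (j : Fin 3) : L2T →L[ℝ] Lp ℂ 2 torusMeasure :=
  (Complex.ofRealCLM.comp (EuclideanSpace.proj j : E3 →L[ℝ] ℝ)).compLpL 2 torusMeasure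

lemma coeFn_component (j : Fin 3) (f : L2T) :
    component j f =ᵐ[torusMeasure] fun y => ((f y j : ℝ) : ℂ) :=
  ContinuousLinearMap.coeFn_compLpL _ f

/-- The exponential `exp (2πi k·y)` as an element of `L²(𝕋³; ℂ)`. -/
def expLp (k : Fin 3 → ℤ) : Lp ℂ 2 torusMeasure := UnitAddTorus.mFourierBasis k

lemma coeFn_expLp (k : Fin 3 → ℤ) :
    expLp k =ᵐ[torusMeasure] fun y => UnitAddTorus.mFourier k y := by
  rw [expLp, UnitAddTorus.coe_mFourierBasis]
  exact UnitAddTorus.coeFn_mFourierLp 2 k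

lemma inner_expLp (k l : Fin 3 → ℤ) :
    inner ℂ (expLp k) (expLp l) = if k = l then 1 else 0 :=
  orthonormal_iff_ite.1 UnitAddTorus.mFourierBasis.orthonormal k l

/-- The Fourier coefficient as a continuous linear map. -/
def fcoeffL (k : Fin 3 → ℤ) (j : Fin 3) : L2T →L[ℝ] ℂ :=
  ((innerSL ℂ (expLp k)).restrictScalars ℝ).comp (component j)

lemma fcoeffL_eq_inner (f : L2T) (k : Fin 3 → ℤ) (j : Fin 3) :
    fcoeffL k j f = inner ℂ (expLp k) (component j f) := rfl

@[simp]
lemma fcoeffL_apply (f : L2T) (k : Fin 3 → ℤ) (j : Fin 3) : fcoeffL k j f = fcoeff f k j := by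
  trans UnitAddTorus.mFourierBasis.repr (component j f) k
  · rw [UnitAddTorus.mFourierBasis.repr_apply_apply]
    rfl
  rw [UnitAddTorus.mFourierBasis_repr]
  refine integral_congr_ae ?_
  filter_upwards [coeFn_component j f] with y hy
  rw [hy]

lemma fcoeff_eq_repr (f : L2T) (k : Fin 3 → ℤ) (j : Fin 3) :
    fcoeff f k j = UnitAddTorus.mFourierBasis.repr (component j f) k := by
  rw [← fcoeffL_apply, UnitAddTorus.mFourierBasis.repr_apply_apply]
  rfl

lemma fcoeff_sub (f g : L2T) (k : Fin 3 → ℤ) (j : Fin 3) :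
    fcoeff (f - g) k j = fcoeff f k j - fcoeff g k j := by
  simp only [← fcoeffL_apply, map_sub]

lemma fcoeff_add (f g : L2T) (k : Fin 3 → ℤ) (j : Fin 3) :
    fcoeff (f + g) k j = fcoeff f k j + fcoeff g k j := by
  simp only [← fcoeffL_apply, map_add]

lemma fcoeff_smul (c : ℝ) (f : L2T) (k : Fin 3 → ℤ) (j : Fin 3) :
    fcoeff (c • f) k j = c • fcoeff f k j := by
  simp only [← fcoeffL_apply, map_smul]

lemma fcoeff_zero (k : Fin 3 → ℤ) (j : Fin 3) : fcoeff (0 : L2T) k j = 0 := by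
  simp only [← fcoeffL_apply, map_zero]

lemma fcoeff_neg (f : L2T) (k : Fin 3 → ℤ) (j : Fin 3) :
    fcoeff f (-k) j = (starRingEnd ℂ) (fcoeff f k j) := by
  rw [fcoeff, fcoeff, UnitAddTorus.mFourierCoeff, UnitAddTorus.mFourierCoeff, ← integral_conj]
  refine integral_congr_ae (ae_of_all _ fun y => ?_)
  simp [UnitAddTorus.mFourier_neg]

/-- Parseval's identity for inner products. -/
lemma hasSum_inner_fcoeff (f g : L2T) :
    HasSum (fun k => ∑ j, inner ℝ (fcoeff f k j) (fcoeff g k j)) (inner ℝ f g) := by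
  have hj : ∀ j, HasSum (fun k => inner ℝ (fcoeff f k j) (fcoeff g k j))
      (inner ℂ (component j f) (component j g)).re := fun j => by
    have h := UnitAddTorus.mFourierBasis.hasSum_inner_mul_inner (component j f) (component j g)
    have h' := Complex.reCLM.hasSum h
    refine h'.congr_fun fun k => ?_
    have e1 : ∀ f : L2T, inner ℂ (UnitAddTorus.mFourierBasis k) (component j f) = fcoeff f k j :=
      fun f => fcoeffL_apply f k j
    rw [← inner_conj_symm (component j f), e1, e1, Complex.inner]
    simp [mul_comm]
  convert! hasSum_sum (s := Finset.univ) fun j _ => hj j using 1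
  have h2 : ∀ j, Integrable (fun y => f y j * g y j) torusMeasure := fun j => by
    have h := (L2.integrable_inner (𝕜 := ℂ) (component j f) (component j g)).re
    refine h.congr ?_
    filter_upwards [coeFn_component j f, coeFn_component j g] with y hy hy'
    rw [hy, hy']
    simp [mul_comm]
  have h3 : ∀ j, (inner ℂ (component j f) (component j g)).re
      = ∫ y, f y j * g y j ∂torusMeasure := fun j => by
    rw [L2.inner_def]
    refine (integral_re (L2.integrable_inner (𝕜 := ℂ) (component j f) (component j g))).symm.trans ?_
    refine integral_congr_ae ?_
    filter_upwards [coeFn_component j f, coeFn_component j g] with y hy hy'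
    rw [hy, hy']
    simp [mul_comm]
  simp only [h3]
  rw [← integral_finsetSum _ fun j _ => h2 j, L2.inner_def]
  refine integral_congr_ae (ae_of_all _ fun y => ?_)
  simp [PiLp.inner_apply, mul_comm]

/-- Parseval's identity for norms. -/
lemma hasSum_norm_fcoeff_sq (f : L2T) :
    HasSum (fun k => ∑ j, ‖fcoeff f k j‖ ^ 2) (‖f‖ ^ 2) := by
  simpa only [real_inner_self_eq_norm_sq] using hasSum_inner_fcoeff f f

lemma ext_fcoeff {f g : L2T} (h : ∀ k j, fcoeff f k j = fcoeff g k j) : f = g := by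
  have h1 : HasSum (fun _ : Fin 3 → ℤ => (0 : ℝ)) (‖f - g‖ ^ 2) := by
    simpa [fcoeff_sub, h] using hasSum_norm_fcoeff_sq (f - g)
  have h2 := h1.unique hasSum_zero
  rwa [sq_eq_zero_iff, norm_eq_zero, sub_eq_zero] at h2

lemma component_fmode (f : L2T) (k : Fin 3 → ℤ) (j : Fin 3) :
    component j (fmode f k) =
      (fcoeff f k j / 2) • expLp k + (fcoeff f (-k) j / 2) • expLp (-k) := by
  apply Lp.ext
  have h0 : fmode f k =ᵐ[torusMeasure] fun y =>
      WithLp.toLp 2 fun j => (fcoeff f k j * UnitAddTorus.mFourier k y).re :=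
    ContinuousMap.coeFn_toLp torusMeasure _
  filter_upwards [coeFn_component j (fmode f k), h0, coeFn_expLp k, coeFn_expLp (-k),
    Lp.coeFn_add ((fcoeff f k j / 2) • expLp k) ((fcoeff f (-k) j / 2) • expLp (-k)),
    Lp.coeFn_smul (fcoeff f k j / 2) (expLp k),
    Lp.coeFn_smul (fcoeff f (-k) j / 2) (expLp (-k))] with y h1 h2 h3 h4 h5 h6 h7
  rw [h1, h2, h5, Pi.add_apply, h6, h7, Pi.smul_apply, Pi.smul_apply, h3, h4, fcoeff_neg,
    UnitAddTorus.mFourier_neg, Complex.re_eq_add_conj]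
  simp only [smul_eq_mul, map_mul]
  ring

/-- Taking the real part splits the mode evenly between `k` and `-k`. At `k = 0` both conditions
hold and the halves add up to the full coefficient. -/
lemma fcoeff_fmode (f : L2T) (k l : Fin 3 → ℤ) (j : Fin 3) :
    fcoeff (fmode f k) l j =
      (if k = l then fcoeff f l j / 2 else 0) + if k = -l then fcoeff f l j / 2 else 0 := by
  rw [← fcoeffL_apply, fcoeffL_eq_inner, component_fmode, inner_add_right, inner_smul_right,
    inner_smul_right, inner_expLp, inner_expLp]
  have h : l = -k ↔ k = -l := ⟨fun h => by rw [h, neg_neg], fun h => by rw [h, neg_neg]⟩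
  congr 1
  · by_cases h1 : k = l
    · simp [h1]
    · simp [h1, Ne.symm h1]
  · by_cases h1 : k = -l
    · simp [h1]
    · simp [h1, h.not.2 h1]

/-- The real vector field with `j`-th component `Re g`, and other components zero. -/
def realLift (j : Fin 3) : Lp ℂ 2 torusMeasure →L[ℝ] L2T :=
  (Complex.reCLM.smulRight (EuclideanSpace.single j (1 : ℝ) : E3)).compLpL 2 torusMeasure

lemma fmode_eq_sum_realLift (f : L2T) (k : Fin 3 → ℤ) :
    fmode f k = ∑ j, realLift j (fcoeff f k j • expLp k) := by
  apply Lp.ext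
  have h0 : fmode f k =ᵐ[torusMeasure] fun y =>
      WithLp.toLp 2 fun j => (fcoeff f k j * UnitAddTorus.mFourier k y).re :=
    ContinuousMap.coeFn_toLp torusMeasure _
  have h1 : ∀ᵐ y ∂torusMeasure, ∀ j, realLift j (fcoeff f k j • expLp k) y
      = (fcoeff f k j * UnitAddTorus.mFourier k y).re • (EuclideanSpace.single j (1 : ℝ) : E3) := by
    rw [ae_all_iff]
    intro j
    filter_upwards [ContinuousLinearMap.coeFn_compLpL
      (Complex.reCLM.smulRight (EuclideanSpace.single j (1 : ℝ) : E3))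
      (fcoeff f k j • expLp k), Lp.coeFn_smul (fcoeff f k j) (expLp k),
      coeFn_expLp k] with y h2 h3 h4
    rw [realLift, h2, h3, Pi.smul_apply, h4]
    simp
  filter_upwards [h0, h1, Lp.coeFn_finsetSum Finset.univ
    (fun j => realLift j (fcoeff f k j • expLp k))] with y h2 h3 h4
  rw [h4, h2]
  ext i
  simp [h3, Finset.sum_apply, Pi.single_apply]

/-- The sum need not converge absolutely in norm. Each component is an expansion in the orthonormal
exponentials with square-summable coefficients, and `realLift` carries its convergence over to real
fields. -/
lemma summable_smul_fmode {σ : (Fin 3 → ℤ) → ℝ} {C : ℝ} (hσ : ∀ k, |σ k| ≤ C) (f : L2T) :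
    Summable fun k => σ k • fmode f k := by
  have hC : 0 ≤ C := (abs_nonneg _).trans (hσ 0)
  have hj : ∀ j, Summable fun k => ((σ k : ℂ) * fcoeff f k j) • expLp k := fun j => by
    have hm : Memℓp (fun k => (σ k : ℂ) * fcoeff f k j) 2 := by
      have h2 : Memℓp (fun k => (C : ℂ) * fcoeff f k j) 2 := by
        simp only [fcoeff_eq_repr]
        exact (lp.memℓp (UnitAddTorus.mFourierBasis.repr (component j f))).const_smul (C : ℂ)
      rw [memℓp_gen_iff (by norm_num)] at h2 ⊢
      refine Summable.of_nonneg_of_le (fun _ => by positivity) (fun k => ?_) h2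
      refine Real.rpow_le_rpow (norm_nonneg _) ?_ (by norm_num)
      rw [norm_mul, norm_mul, Complex.norm_real, Complex.norm_real, Real.norm_of_nonneg hC]
      exact mul_le_mul_of_nonneg_right (hσ k) (norm_nonneg _)
    exact (UnitAddTorus.mFourierBasis.hasSum_repr_symm ⟨_, hm⟩).summable
  refine (summable_sum (s := Finset.univ) fun j _ =>
    (realLift j).summable (hj j)).congr fun k => ?_
  rw [fmode_eq_sum_realLift, Finset.smul_sum]
  refine Finset.sum_congr rfl fun j _ => ?_
  rw [← map_smul, mul_smul]
  congr 1

lemma fcoeff_fourierMultiplier {σ : (Fin 3 → ℤ) → ℝ} {C : ℝ} (hσ : ∀ k, |σ k| ≤ C)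
    (hσ' : ∀ k, σ (-k) = σ k) (f : L2T) (l : Fin 3 → ℤ) (j : Fin 3) :
    fcoeff (fourierMultiplier σ f) l j = σ l • fcoeff f l j := by
  have h := (fcoeffL l j).hasSum (summable_smul_fmode hσ f).hasSum
  simp only [map_smul, fcoeffL_apply, fcoeff_fmode] at h
  rw [fourierMultiplier]
  refine h.unique ?_
  -- The coefficient at `l` receives one half from `k = l` and one half from `k = -l`; evenness of
  -- `σ` gives both the same weight.
  have h1 : HasSum (fun k => σ k • if k = l then fcoeff f l j / 2 else 0)
      (σ l • (fcoeff f l j / 2)) := by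
    convert! hasSum_single (f := fun k => σ k • if k = l then fcoeff f l j / 2 else 0) l
      (fun k hk => by simp [hk]) using 1
    simp
  have h2 : HasSum (fun k => σ k • if k = -l then fcoeff f l j / 2 else 0)
      (σ l • (fcoeff f l j / 2)) := by
    convert! hasSum_single (f := fun k => σ k • if k = -l then fcoeff f l j / 2 else 0) (-l)
      (fun k hk => by simp [hk]) using 1
    simp [hσ']
  convert! h1.add h2 using 1
  · ext k
    simp [smul_add]
  · rw [← smul_add, add_halves]

@[simp]
lemma lat_neg (k : Fin 3 → ℤ) : lat (-k) = -lat k := by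
  ext j
  simp [lat]

lemma fcoeff_heat {t : ℝ} (ht : 0 ≤ t) (f : L2T) (k : Fin 3 → ℤ) (j : Fin 3) :
    fcoeff (heat t f) k j =
      Real.exp (-(4 * Real.pi ^ 2 * ‖lat k‖ ^ 2 * t)) • fcoeff f k j := by
  refine fcoeff_fourierMultiplier (C := 1) (fun k => ?_) (fun k => ?_) f k j
  · rw [abs_of_nonneg (Real.exp_nonneg _), Real.exp_le_one_iff, neg_nonpos]
    positivity
  · rw [lat_neg, norm_neg]

/-! ### Sobolev norms -/

lemma sobolevTerm_nonneg (s : ℝ) (f : L2T) (k : Fin 3 → ℤ) : 0 ≤ sobolevTerm s f k := by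
  unfold sobolevTerm
  positivity

lemma norm_fcoeff_sq_le_sobolevTerm {s : ℝ} (hs : 0 ≤ s) (f : L2T) (k : Fin 3 → ℤ) :
    ∑ j, ‖fcoeff f k j‖ ^ 2 ≤ sobolevTerm s f k := by
  refine le_mul_of_one_le_left (by positivity) (Real.one_le_rpow ?_ hs)
  linarith [show 0 ≤ 4 * Real.pi ^ 2 * ‖lat k‖ ^ 2 by positivity]

lemma summable_sobolevTerm_sub {s : ℝ} {f g : L2T} (hf : Summable (sobolevTerm s f))
    (hg : Summable (sobolevTerm s g)) : Summable (sobolevTerm s (f - g)) := by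
  refine Summable.of_nonneg_of_le (sobolevTerm_nonneg s _) (fun k => ?_)
    ((hf.mul_left 2).add (hg.mul_left 2))
  unfold sobolevTerm
  have h : ∑ j, ‖fcoeff (f - g) k j‖ ^ 2 ≤
      2 * ∑ j, ‖fcoeff f k j‖ ^ 2 + 2 * ∑ j, ‖fcoeff g k j‖ ^ 2 := by
    rw [Finset.mul_sum, Finset.mul_sum, ← Finset.sum_add_distrib]
    refine Finset.sum_le_sum fun j _ => ?_
    rw [fcoeff_sub]
    nlinarith [norm_sub_le (fcoeff f k j) (fcoeff g k j), norm_nonneg (fcoeff f k j - fcoeff g k j),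
      sq_nonneg (‖fcoeff f k j‖ - ‖fcoeff g k j‖)]
  have h0 : 0 ≤ (1 + 4 * Real.pi ^ 2 * ‖lat k‖ ^ 2) ^ s := by positivity
  nlinarith [mul_le_mul_of_nonneg_left h h0]

lemma sobolevNorm_sq (s : ℝ) (f : L2T) : sobolevNorm s f ^ 2 = ∑' k, sobolevTerm s f k :=
  Real.sq_sqrt (tsum_nonneg (sobolevTerm_nonneg s f))

lemma sobolevNorm_nonneg (s : ℝ) (f : L2T) : 0 ≤ sobolevNorm s f := Real.sqrt_nonneg _

lemma norm_le_sobolevNorm {s : ℝ} (hs : 0 ≤ s) {f : L2T} (hf : Summable (sobolevTerm s f)) :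
    ‖f‖ ≤ sobolevNorm s f := by
  refine Real.le_sqrt_of_sq_le ?_
  rw [← (hasSum_norm_fcoeff_sq f).tsum_eq]
  exact (hasSum_norm_fcoeff_sq f).summable.tsum_le_tsum
    (norm_fcoeff_sq_le_sobolevTerm hs f) hf

/-- A termwise substitute for the triangle inequality; the lost factor 2 is harmless, since only
boundedness on compact intervals is wanted. -/
lemma sobolevNorm_sq_le {s : ℝ} {f g : L2T} (hf : Summable (sobolevTerm s f))
    (hg : Summable (sobolevTerm s g)) :
    sobolevNorm s f ^ 2 ≤ 2 * sobolevNorm s (f - g) ^ 2 + 2 * sobolevNorm s g ^ 2 := by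
  have hd := summable_sobolevTerm_sub hf hg
  rw [sobolevNorm_sq, sobolevNorm_sq, sobolevNorm_sq, ← tsum_mul_left, ← tsum_mul_left,
    ← (hd.mul_left 2).tsum_add (hg.mul_left 2)]
  refine hf.tsum_le_tsum (fun k => ?_) ((hd.mul_left 2).add (hg.mul_left 2))
  unfold sobolevTerm
  have h : ∑ j, ‖fcoeff f k j‖ ^ 2 ≤
      2 * ∑ j, ‖fcoeff (f - g) k j‖ ^ 2 + 2 * ∑ j, ‖fcoeff g k j‖ ^ 2 := by
    rw [Finset.mul_sum, Finset.mul_sum, ← Finset.sum_add_distrib]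
    refine Finset.sum_le_sum fun j _ => ?_
    rw [fcoeff_sub]
    have h1 := norm_add_le (fcoeff f k j - fcoeff g k j) (fcoeff g k j)
    rw [sub_add_cancel] at h1
    nlinarith [norm_nonneg (fcoeff f k j),
      sq_nonneg (‖fcoeff f k j - fcoeff g k j‖ - ‖fcoeff g k j‖)]
  have h0 : 0 ≤ (1 + 4 * Real.pi ^ 2 * ‖lat k‖ ^ 2) ^ s := by positivity
  nlinarith [mul_le_mul_of_nonneg_left h h0]

/-- A curve that is continuous in `Hˢ` is bounded in `Hˢ` on compact time intervals. -/
lemma exists_sobolevNorm_le {s : ℝ} {u : ℝ → L2T} (hu : ∀ t, 0 ≤ t → Summable (sobolevTerm s (u t)))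
    (hc : ∀ t, 0 ≤ t → Tendsto (fun r => sobolevNorm s (u r - u t)) (𝓝[Ici 0] t) (𝓝 0)) (T : ℝ) :
    ∃ M, 0 ≤ M ∧ ∀ t ∈ Icc 0 T, sobolevNorm s (u t) ≤ M := by
  suffices h : ∃ M, ∀ t ∈ Icc 0 T, sobolevNorm s (u t) ≤ M by
    obtain ⟨M, hM⟩ := h
    exact ⟨max M 0, le_max_right _ _, fun t ht => (hM t ht).trans (le_max_left _ _)⟩
  refine isCompact_Icc.induction_on (p := fun S => ∃ M, ∀ t ∈ S, sobolevNorm s (u t) ≤ M)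
    ⟨0, by simp⟩ (fun S S' hS ⟨M, hM⟩ => ⟨M, fun t ht => hM t (hS ht)⟩) ?_ ?_
  · rintro S S' ⟨M, hM⟩ ⟨M', hM'⟩
    refine ⟨max M M', fun t ht => ?_⟩
    rcases ht with ht | ht
    · exact (hM t ht).trans (le_max_left _ _)
    · exact (hM' t ht).trans (le_max_right _ _)
  · intro t ht
    have h1 : ∀ᶠ r in 𝓝[Icc 0 T] t, sobolevNorm s (u r - u t) < 1 :=
      ((hc t ht.1).mono_left (nhdsWithin_mono _ Icc_subset_Ici_self)).eventually_lt_const one_pos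
    refine ⟨_, h1.and self_mem_nhdsWithin, √(2 + 2 * sobolevNorm s (u t) ^ 2), fun r hr => ?_⟩
    refine Real.le_sqrt_of_sq_le ((sobolevNorm_sq_le (hu r hr.2.1) (hu t ht.1)).trans ?_)
    have := sobolevNorm_nonneg s (u r - u t)
    have := hr.1
    nlinarith

/-! ### Fourier coefficients of periodizations -/

lemma exists_rep_coe (x : Fin 3 → ℝ) :
    ∃ l, rep (fun i => (x i : UnitAddCircle)) = WithLp.toLp 2 x + lat l := by
  refine ⟨fun i => -⌊x i⌋, ?_⟩
  ext i
  simp only [rep, lat, PiLp.add_apply]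
  rw [AddCircle.coe_equivIco_mk_apply]
  simp [Int.fract, sub_eq_add_neg]

lemma lat_add (k l : Fin 3 → ℤ) : lat (k + l) = lat k + lat l := by
  ext j
  simp [lat]

lemma periodize_coe (g : E3 → E3) (x : Fin 3 → ℝ) :
    periodize g (fun i => (x i : UnitAddCircle)) = ∑' l, g (WithLp.toLp 2 x + lat l) := by
  obtain ⟨l₀, h⟩ := exists_rep_coe x
  rw [periodize, h]
  rw [← (Equiv.addLeft l₀).tsum_eq fun l => g (WithLp.toLp 2 x + lat l)]
  simp only [Equiv.coe_addLeft, lat_add, add_assoc]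

lemma summable_comp_add_lat {g : E3 → E3} {C : ℝ} (hC : ∀ x, (1 + ‖x‖) ^ 6 * ‖g x‖ ≤ C) (x : E3) :
    Summable fun l => g (x + lat l) := by
  refine Summable.of_norm_bounded (summable_lat.mul_left ((1 + ‖x‖) ^ 6 * C)) fun l => ?_
  have h1 : 1 + ‖lat l‖ ≤ (1 + ‖x‖) * (1 + ‖x + lat l‖) := by
    have := norm_sub_le (x + lat l) x
    rw [add_sub_cancel_left] at this
    nlinarith [norm_nonneg x, norm_nonneg (x + lat l),
      mul_nonneg (norm_nonneg x) (norm_nonneg (x + lat l))]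
  rw [← div_eq_mul_inv, le_div_iff₀ (by positivity), mul_comm]
  calc _ ≤ ((1 + ‖x‖) * (1 + ‖x + lat l‖)) ^ 6 * ‖g (x + lat l)‖ := by gcongr
    _ = (1 + ‖x‖) ^ 6 * ((1 + ‖x + lat l‖) ^ 6 * ‖g (x + lat l)‖) := by ring
    _ ≤ _ := by gcongr; exact hC _

lemma integrable_of_decay {g : E3 → E3} (hg : Continuous g) {C : ℝ}
    (hC : ∀ x, (1 + ‖x‖) ^ 6 * ‖g x‖ ≤ C) : Integrable g := by
  have h : Integrable fun x : E3 => C * (1 + ‖x‖) ^ (-(6 : ℝ)) :=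
    (integrable_one_add_norm (by simp; norm_num)).const_mul C
  refine h.mono' hg.aestronglyMeasurable (ae_of_all _ fun x => ?_)
  rw [Real.rpow_neg (by positivity), ← div_eq_mul_inv, le_div_iff₀ (by positivity), mul_comm]
  exact_mod_cast hC x

/-- The half-open unit cube with corner `l`. -/
def cube (l : Fin 3 → ℤ) : Set (Fin 3 → ℝ) := {x | ∀ i, x i ∈ Ioc (l i : ℝ) (l i + 1)}

lemma measurableSet_cube (l : Fin 3 → ℤ) : MeasurableSet (cube l) :=
  MeasurableSet.univ_pi' fun _ => measurableSet_Ioc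

/-- With intervals open on the left, membership is an equation between ceilings, which makes
covering, disjointness and translation immediate. The same intervals occur in
`UnitAddTorus.mFourierCoeff_eq_integral`. -/
lemma mem_cube_iff {l : Fin 3 → ℤ} {x : Fin 3 → ℝ} : x ∈ cube l ↔ ∀ i, ⌈x i⌉ = l i + 1 := by
  simp only [cube, mem_ofPred_eq, mem_Ioc, Int.ceil_eq_iff]
  refine forall_congr' fun i => ?_
  push_cast
  rw [add_sub_cancel_right]

lemma iUnion_cube : ⋃ l, cube l = univ := by
  refine eq_univ_of_forall fun x => mem_iUnion.2 ⟨fun i => ⌈x i⌉ - 1, ?_⟩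
  rw [mem_cube_iff]
  intro i
  ring

lemma pairwise_disjoint_cube : Pairwise (Function.onFun Disjoint cube) := by
  intro l l' h
  refine Set.disjoint_left.2 fun x hx hx' => h (funext fun i => ?_)
  rw [mem_cube_iff] at hx hx'
  linarith [hx i, hx' i]

lemma hasSum_setIntegral_cube {F : Type*} [NormedAddCommGroup F] [NormedSpace ℝ F]
    {h : (Fin 3 → ℝ) → F} (hh : Integrable h) :
    HasSum (fun l : Fin 3 → ℤ => ∫ x in cube 0, h (x + fun i => (l i : ℝ))) (∫ x, h x) := by
  have h1 := hasSum_integral_iUnion (f := h) measurableSet_cube pairwise_disjoint_cube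
    (by rw [iUnion_cube]; exact hh.integrableOn)
  rw [iUnion_cube, setIntegral_univ] at h1
  refine h1.congr_fun fun l => ?_
  have h2 := (measurePreserving_add_right volume (fun i => (l i : ℝ))).setIntegral_preimage_emb
    (measurableEmbedding_addRight _) h (cube l)
  rw [← h2]
  congr 2
  ext x
  rw [mem_preimage, mem_cube_iff, mem_cube_iff]
  refine forall_congr' fun i => ?_
  rw [Pi.add_apply, Int.ceil_add_intCast, Pi.zero_apply]
  constructor <;> intro h <;> linarith

lemma mFourier_coe (k : Fin 3 → ℤ) (x : Fin 3 → ℝ) :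
    UnitAddTorus.mFourier k (fun i => (x i : UnitAddCircle)) =
      Complex.exp (((2 * Real.pi * inner ℝ (WithLp.toLp 2 x) (lat k) : ℝ) : ℂ) * Complex.I) := by
  simp only [UnitAddTorus.mFourier, ContinuousMap.coe_mk, fourier_coe_apply, ← Complex.exp_sum]
  congr 1
  simp only [PiLp.inner_apply, lat, RCLike.inner_apply, conj_trivial]
  push_cast
  rw [Finset.mul_sum, Finset.sum_mul]
  refine Finset.sum_congr rfl fun i _ => ?_
  ring

/-- The Fourier coefficients of a periodization are the values of the Fourier transform. -/
lemma fcoeff_periodize {g : E3 → E3} (hg : Continuous g) {C : ℝ}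
    (hC : ∀ x, (1 + ‖x‖) ^ 6 * ‖g x‖ ≤ C) (hp : MemLp (periodize g) 2 torusMeasure)
    (k : Fin 3 → ℤ) (j : Fin 3) :
    fcoeff (hp.toLp (periodize g)) k j = 𝓕 (fun x : E3 => ((g x j : ℝ) : ℂ)) (lat k) := by
  set e : (Fin 3 → ℝ) → ℂ := fun x => UnitAddTorus.mFourier (-k) (fun i => (x i : UnitAddCircle))
  -- Periodicity lets the exponential pass through the lattice sum, so that the integral over one
  -- cube unfolds to an integral over the whole space.
  have he : ∀ x (l : Fin 3 → ℤ), e (x + fun i => (l i : ℝ)) = e x := fun x l => by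
    simp only [e]
    congr 1
    ext i
    simp
  have he1 : ∀ x, ‖e x‖ = 1 := fun x => by
    simp only [e, mFourier_coe, Complex.norm_exp_ofReal_mul_I]
  have hec : Continuous e := by fun_prop
  set h : (Fin 3 → ℝ) → ℂ := fun x => e x * ((g (WithLp.toLp 2 x) j : ℝ) : ℂ) with hh
  have hgi : Integrable fun x : Fin 3 → ℝ => g (WithLp.toLp 2 x) :=
    ((PiLp.volume_preserving_toLp (Fin 3)).integrable_comp_emb
      (MeasurableEquiv.toLp 2 _).measurableEmbedding).2 (integrable_of_decay hg hC)
  have hi : Integrable h := by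
    refine hgi.mono ?_ (ae_of_all _ fun x => ?_)
    · exact (hec.mul (by fun_prop)).aestronglyMeasurable
    · rw [hh, norm_mul, he1, one_mul, Complex.norm_real]
      exact PiLp.norm_apply_le _ j
  have hpt : ∀ x, ∑' l : Fin 3 → ℤ, h (x + fun i => (l i : ℝ)) =
      e x * ((periodize g (fun i => (x i : UnitAddCircle)) j : ℝ) : ℂ) := fun x => by
    have h1 := (Complex.ofRealCLM.comp (EuclideanSpace.proj j : E3 →L[ℝ] ℝ)).map_tsum
      (summable_comp_add_lat hC (WithLp.toLp 2 x))
    change (((∑' l, g (WithLp.toLp 2 x + lat l)) j : ℝ) : ℂ) =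
      ∑' l, ((g (WithLp.toLp 2 x + lat l) j : ℝ) : ℂ) at h1
    rw [periodize_coe, h1, ← tsum_mul_left]
    refine tsum_congr fun l => ?_
    rw [hh]
    simp only [he]
    rfl
  have h2 := hasSum_setIntegral_cube hi
  -- Sum and integral are exchanged; the summability needed is the unfolding identity applied to
  -- `‖h‖`.
  have h3 := hasSum_integral_of_summable_integral_norm
    (F := fun (l : Fin 3 → ℤ) x => h (x + fun i => (l i : ℝ))) (μ := volume.restrict (cube 0))
    (fun l => (hi.comp_add_right _).integrableOn) (hasSum_setIntegral_cube hi.norm).summable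
  have h4 := h3.unique h2
  simp only [hpt] at h4
  have h5 : fcoeff (hp.toLp (periodize g)) k j =
      UnitAddTorus.mFourierCoeff (fun y => ((periodize g y j : ℝ) : ℂ)) k := by
    refine integral_congr_ae ?_
    filter_upwards [hp.coeFn_toLp] with y hy
    rw [hy]
  rw [h5, UnitAddTorus.mFourierCoeff_eq_integral _ _ 0]
  have h6 : {x : Fin 3 → ℝ | ∀ i, x i ∈ Ioc ((0 : Fin 3 → ℝ) i) ((0 : Fin 3 → ℝ) i + 1)}
      = cube 0 := by simp [cube]
  rw [h6]
  refine h4.trans ?_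
  rw [Real.fourier_eq', ← (PiLp.volume_preserving_toLp (Fin 3)).integral_comp
    (MeasurableEquiv.toLp 2 _).measurableEmbedding]
  refine integral_congr_ae (ae_of_all _ fun x => ?_)
  simp only [hh, e, mFourier_coe, lat_neg, inner_neg_right, smul_eq_mul]
  congr 4
  ring

namespace CascadeProfile

variable {ε₀ : ℝ} {m : ℕ} (D : CascadeProfile ε₀ m)

/-! ### The frequency regions -/

lemma one_lt_ratio (D : CascadeProfile ε₀ m) : 1 < 1 + ε₀ := by linarith [D.eps_pos]

lemma ratio_pos (D : CascadeProfile ε₀ m) : 0 < 1 + ε₀ := by linarith [D.eps_pos]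

lemma ratio_zpow_pos (D : CascadeProfile ε₀ m) (n : ℤ) : 0 < (1 + ε₀) ^ n := zpow_pos D.ratio_pos n

lemma mem_region_iff {i : Fin m} {n : ℤ} {ξ : E3} : ξ ∈ D.region i n ↔
    ((1 + ε₀) ^ n)⁻¹ • ξ ∈
      Metric.ball (D.center i) (D.radius i) ∪ -Metric.ball (D.center i) (D.radius i) :=
  Set.mem_smul_set_iff_inv_smul_mem₀ (D.ratio_zpow_pos n).ne' _ _

lemma neg_mem_region_iff {i : Fin m} {n : ℤ} {ξ : E3} : -ξ ∈ D.region i n ↔ ξ ∈ D.region i n := by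
  rw [mem_region_iff, mem_region_iff, smul_neg, mem_union, mem_union, Set.mem_neg, Set.mem_neg,
    neg_neg, or_comm]

lemma norm_of_mem_region {i : Fin m} {n : ℤ} {ξ : E3} (h : ξ ∈ D.region i n) :
    (1 + ε₀) ^ n < ‖ξ‖ ∧ ‖ξ‖ < (1 + ε₀) ^ n * (1 + ε₀ / 2) := by
  have hp := D.ratio_zpow_pos n
  have h1 : 1 < ‖((1 + ε₀) ^ n)⁻¹ • ξ‖ ∧ ‖((1 + ε₀) ^ n)⁻¹ • ξ‖ < 1 + ε₀ / 2 := by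
    rcases D.mem_region_iff.1 h with h | h
    · exact D.ball_subset i h
    · rw [← norm_neg]
      exact D.ball_subset i h
  rw [norm_smul, norm_inv, Real.norm_of_nonneg hp.le, inv_mul_eq_div, one_lt_div hp,
    div_lt_iff₀' hp] at h1
  exact h1

/-- Different scales lie in disjoint annuli because `1 + ε₀/2 < 1 + ε₀`; at equal scales the balls
and their reflections are disjoint by assumption. -/
lemma region_injective {i i' : Fin m} {n n' : ℤ} {ξ : E3} (h : ξ ∈ D.region i n)
    (h' : ξ ∈ D.region i' n') : i = i' ∧ n = n' := by
  have key : ∀ {i i' : Fin m} {n n' : ℤ}, ξ ∈ D.region i n → ξ ∈ D.region i' n' → n ≤ n' := by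
    intro i i' n n' h h'
    by_contra! hlt
    have h1 := (D.norm_of_mem_region h).1
    have h2 := (D.norm_of_mem_region h').2
    have h3 : (1 + ε₀) ^ (n' + 1) ≤ (1 + ε₀) ^ n := zpow_le_zpow_right₀ D.one_lt_ratio.le hlt
    rw [zpow_add_one₀ D.ratio_pos.ne'] at h3
    nlinarith [D.ratio_zpow_pos n', D.eps_pos]
  have hn : n = n' := le_antisymm (key h h') (key h' h)
  subst hn
  refine ⟨?_, rfl⟩
  by_contra hne
  rw [mem_region_iff] at h h'
  rcases h with h | h <;> rcases h' with h' | h'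
  · exact Set.disjoint_left.1 (D.ball_disjoint i i' hne) h h'
  · exact Set.disjoint_left.1 (D.ball_neg_disjoint i i') h h'
  · exact Set.disjoint_left.1 (D.ball_neg_disjoint i' i) h' h
  · exact Set.disjoint_left.1 (D.ball_disjoint i i' hne) h h'

lemma one_le_norm_lat {k : Fin 3 → ℤ} (hk : k ≠ 0) : 1 ≤ ‖lat k‖ := by
  obtain ⟨j, hj⟩ := Function.ne_iff.1 hk
  have h1 : |(k j : ℝ)| ≤ ‖lat k‖ := PiLp.norm_apply_le (lat k) j
  refine le_trans ?_ h1
  exact_mod_cast Int.one_le_abs hj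

/-- For `n < 0` the outer radius is below `(1+ε₀)^(n+1) ≤ 1`, while nonzero lattice points have norm
at least 1; the origin is excluded by the inner radius. -/
lemma lat_notMem_region {i : Fin m} {n : ℤ} (hn : n < 0) (k : Fin 3 → ℤ) :
    lat k ∉ D.region i n := by
  intro h
  obtain ⟨h1, h2⟩ := D.norm_of_mem_region h
  have hk : k ≠ 0 := by
    rintro rfl
    have h0 : lat 0 = 0 := by ext; simp [lat]
    rw [h0, norm_zero] at h1
    exact absurd h1 (D.ratio_zpow_pos n).le.not_gt
  have h3 := one_le_norm_lat hk
  have h4 : (1 + ε₀) ^ (n + 1) ≤ (1 + ε₀) ^ (0 : ℤ) := zpow_le_zpow_right₀ D.one_lt_ratio.le hn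
  rw [zpow_add_one₀ D.ratio_pos.ne', zpow_zero] at h4
  nlinarith [D.ratio_zpow_pos n, D.eps_pos]

lemma finite_lat_mem_region (i : Fin m) (n : ℤ) : {k | lat k ∈ D.region i n}.Finite := by
  set R : ℤ := ⌈(1 + ε₀) ^ n * (1 + ε₀ / 2)⌉
  refine (Set.finite_Icc (fun _ : Fin 3 => -R) (fun _ => R)).subset fun k hk => ?_
  have h2 : ∀ j, |k j| ≤ R := fun j => by
    have h1 : |(k j : ℝ)| ≤ ‖lat k‖ := PiLp.norm_apply_le (lat k) j
    have h3 := h1.trans ((D.norm_of_mem_region hk).2.le.trans (Int.le_ceil _))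
    exact_mod_cast h3
  exact ⟨fun j => (abs_le.1 (h2 j)).1, fun j => (abs_le.1 (h2 j)).2⟩

/-- The lattice points in the frequency region `(1 + ε₀) ^ n (B i ∪ -B i)`. -/
def freq (i : Fin m) (n : ℤ) : Finset (Fin 3 → ℤ) := (D.finite_lat_mem_region i n).toFinset

lemma mem_freq {i : Fin m} {n : ℤ} {k : Fin 3 → ℤ} : k ∈ D.freq i n ↔ lat k ∈ D.region i n := by
  simp [freq]

lemma freq_eq_empty {i : Fin m} {n : ℤ} (hn : n < 0) : D.freq i n = ∅ :=
  Finset.eq_empty_of_forall_notMem fun k hk => D.lat_notMem_region hn k (D.mem_freq.1 hk)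

open Classical in
lemma fcoeff_localize (i : Fin m) (n : ℤ) (f : L2T) (k : Fin 3 → ℤ) (j : Fin 3) :
    fcoeff (D.localize i n f) k j = if lat k ∈ D.region i n then fcoeff f k j else 0 := by
  rw [localize, fcoeff_fourierMultiplier (C := 1)]
  · split_ifs <;> simp
  · intro k
    split_ifs <;> simp
  · intro k
    simp only [lat_neg, neg_mem_region_iff]

/-! ### The normalized periodized profiles -/

lemma fourier_dilate {a : ℝ} (ha : 0 < a) (n : ℤ) (ψ : E3 → E3) (j : Fin 3) (w : E3) :
    𝓕 (fun x : E3 => ((dilate a n ψ x j : ℝ) : ℂ)) w =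
      (a ^ (3 * (n : ℝ) / 2) * ((a ^ n) ^ 3)⁻¹ : ℝ) •
        𝓕 (fun x : E3 => ((ψ x j : ℝ) : ℂ)) ((a ^ n)⁻¹ • w) := by
  have hb : 0 < a ^ n := zpow_pos ha n
  rw [Real.fourier_eq', Real.fourier_eq', mul_smul]
  have h := Measure.integral_comp_smul (volume : Measure E3) (fun y : E3 =>
    Complex.exp (((-2 * Real.pi * inner ℝ y ((a ^ n)⁻¹ • w) : ℝ) : ℂ) * Complex.I) •
      ((ψ y j : ℝ) : ℂ)) (a ^ n)
  rw [finrank_euclideanSpace_fin, abs_of_pos (by positivity)] at h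
  rw [← h, ← integral_smul]
  congr 1
  ext x
  rw [dilate, inner_smul_left, inner_smul_right]
  simp only [conj_trivial, mul_inv_cancel_left₀ hb.ne', PiLp.smul_apply, smul_eq_mul,
    Complex.real_smul]
  push_cast
  ring

lemma fcoeff_psiPer (i : Fin m) (n : ℤ) (k : Fin 3 → ℤ) (j : Fin 3) :
    fcoeff (D.psiPer i n) k j =
      ((1 + ε₀) ^ (3 * (n : ℝ) / 2) * (((1 + ε₀) ^ n) ^ 3)⁻¹ : ℝ) •
        𝓕 (fun x : E3 => ((D.ψ i x j : ℝ) : ℂ)) (((1 + ε₀) ^ n)⁻¹ • lat k) := by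
  obtain ⟨C, hC⟩ := dilate_decay D.ratio_pos n (D.ψ i)
  rw [psiPer, fcoeff_periodize _ hC, fourier_dilate D.ratio_pos]
  exact ((D.ψ i).continuous.comp (continuous_const_smul ((1 + ε₀) ^ n))).const_smul
    ((1 + ε₀) ^ (3 * (n : ℝ) / 2))

lemma fcoeff_psiNorm_eq_zero {i : Fin m} {n : ℤ} {k : Fin 3 → ℤ} (hk : lat k ∉ D.region i n)
    (j : Fin 3) : fcoeff (D.psiNorm i n) k j = 0 := by
  rw [psiNorm, fcoeff_smul, fcoeff_psiPer, D.fourier_support i _ (D.mem_region_iff.not.1 hk) j,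
    smul_zero, smul_zero]

lemma norm_psiNorm {i : Fin m} {n : ℤ} (h : D.psiPer i n ≠ 0) : ‖D.psiNorm i n‖ = 1 := by
  rw [psiNorm, norm_smul, norm_inv, norm_norm, inv_mul_cancel₀ (norm_ne_zero_iff.2 h)]

lemma norm_psiNorm_le (i : Fin m) (n : ℤ) : ‖D.psiNorm i n‖ ≤ 1 := by
  by_cases h : D.psiPer i n = 0
  · simp [psiNorm, h]
  · exact (D.norm_psiNorm h).le

/-- Otherwise Fourier inversion would give `ψ i = 0`, against its unit `L²` norm. -/
lemma exists_fourier_ne_zero (i : Fin m) :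
    ∃ j ξ, 𝓕 (fun x : E3 => ((D.ψ i x j : ℝ) : ℂ)) ξ ≠ 0 := by
  by_contra! h
  have h1 : ∀ x, D.ψ i x = 0 := fun x => by
    ext j
    set g : E3 → ℂ := fun x => ((D.ψ i x j : ℝ) : ℂ) with hg
    have hc : Continuous g := by
      have := (D.ψ i).continuous
      fun_prop
    have hi : Integrable g := by
      refine (D.ψ i).integrable.mono hc.aestronglyMeasurable (ae_of_all _ fun x => ?_)
      rw [hg, Complex.norm_real]
      exact PiLp.norm_apply_le _ j
    have h0 : 𝓕 g = 0 := funext fun ξ => h j ξ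
    have h2 := hc.fourierInv_fourier_eq hi (by rw [h0]; exact integrable_zero _ _ _)
    have h3 : g x = 0 := by
      rw [← h2, h0, Real.fourierInv_eq]
      simp
    exact Complex.ofReal_eq_zero.1 h3
  have h2 := D.norm_one i
  simp [h1] at h2

lemma exists_lat_near {b : ℝ} (hb : 0 < b) (ξ : E3) :
    ∃ k, ‖b⁻¹ • lat k - ξ‖ ≤ b⁻¹ := by
  refine ⟨fun j => round (b * ξ j), ?_⟩
  have h : b⁻¹ • lat (fun j => round (b * ξ j)) - ξ =
      b⁻¹ • (lat (fun j => round (b * ξ j)) - b • ξ) := by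
    rw [smul_sub, smul_smul, inv_mul_cancel₀ hb.ne', one_smul]
  rw [h, norm_smul, norm_inv, Real.norm_of_nonneg hb.le]
  refine mul_le_of_le_one_right (by positivity) ?_
  rw [EuclideanSpace.norm_eq, Real.sqrt_le_left one_pos.le, one_pow]
  -- Rounding costs at most `1/2` per coordinate, hence at most `√3/2 < 1` in norm.
  have hj : ∀ j, ‖(lat (fun j => round (b * ξ j)) - b • ξ) j‖ ^ 2 ≤ 1 / 4 := fun j => by
    have h1 := abs_sub_round (b * ξ j)
    rw [abs_sub_comm] at h1
    have h2 : (lat (fun j => round (b * ξ j)) - b • ξ) j = round (b * ξ j) - b * ξ j := rfl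
    rw [h2, Real.norm_eq_abs]
    nlinarith [abs_nonneg ((round (b * ξ j) : ℝ) - b * ξ j)]
  rw [Fin.sum_univ_three]
  linarith [hj 0, hj 1, hj 2]

/-- The transform is continuous and nonzero on some ball; for large `n` the rescaled lattice
`(1+ε₀)^(-n) ℤ³` is fine enough to meet that ball. -/
lemma exists_psiPer_ne_zero (i : Fin m) : ∃ N : ℕ, ∀ n : ℤ, (N : ℤ) ≤ n → D.psiPer i n ≠ 0 := by
  obtain ⟨j, ξ, hξ⟩ := D.exists_fourier_ne_zero i
  set F : E3 → ℂ := 𝓕 (fun x : E3 => ((D.ψ i x j : ℝ) : ℂ)) with hF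
  have hi : Integrable (fun x : E3 => ((D.ψ i x j : ℝ) : ℂ)) := by
    have := (D.ψ i).continuous
    refine (D.ψ i).integrable.mono (by fun_prop) (ae_of_all _ fun x => ?_)
    rw [Complex.norm_real]
    exact PiLp.norm_apply_le _ j
  have hc : Continuous F := VectorFourier.fourierIntegral_continuous Real.continuous_fourierChar
    (by exact continuous_inner) hi
  obtain ⟨r, hr, hball⟩ := Metric.eventually_nhds_iff.1 (hc.continuousAt.eventually_ne hξ)
  obtain ⟨N, hN⟩ := pow_unbounded_of_one_lt r⁻¹ D.one_lt_ratio
  refine ⟨N, fun n hn h0 => ?_⟩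
  have hb := D.ratio_zpow_pos n
  obtain ⟨k, hk⟩ := exists_lat_near hb ξ
  have h1 : ((1 + ε₀) ^ n)⁻¹ < r := by
    rw [inv_lt_comm₀ hb hr]
    refine hN.trans_le ?_
    rw [← zpow_natCast]
    exact zpow_le_zpow_right₀ D.one_lt_ratio.le hn
  have h2 : F (((1 + ε₀) ^ n)⁻¹ • lat k) ≠ 0 := hball (by rw [dist_eq_norm]; exact hk.trans_lt h1)
  have h3 := D.fcoeff_psiPer i n k j
  rw [h0, fcoeff_zero] at h3
  refine smul_ne_zero ?_ h2 h3.symm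
  have h4 : 0 < (1 + ε₀) ^ (3 * (n : ℝ) / 2) := Real.rpow_pos_of_pos D.ratio_pos _
  positivity

lemma exists_forall_psiPer_ne_zero :
    ∃ N : ℕ, ∀ (i : Fin m) (n : ℤ), (N : ℤ) ≤ n → D.psiPer i n ≠ 0 := by
  choose N hN using D.exists_psiPer_ne_zero
  refine ⟨Finset.univ.sup N, fun i n hn => hN i n (le_trans ?_ hn)⟩
  exact_mod_cast Finset.le_sup (f := N) (Finset.mem_univ i)

end CascadeProfile

namespace CascadeProfile

variable {ε₀ : ℝ} {m : ℕ} (D : CascadeProfile ε₀ m)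

/-! ### Coefficients and local energies -/

/-- The pairs of a frequency in `(1 + ε₀) ^ n (B i ∪ -B i)` and a component. -/
def modes (i : Fin m) (n : ℤ) : Finset ((Fin 3 → ℤ) × Fin 3) := D.freq i n ×ˢ Finset.univ

lemma mem_modes {i : Fin m} {n : ℤ} {p : (Fin 3 → ℤ) × Fin 3} :
    p ∈ D.modes i n ↔ lat p.1 ∈ D.region i n := by
  simp [modes, mem_freq]

lemma inner_psiNorm_eq_sum (f : L2T) (i : Fin m) (n : ℤ) :
    inner ℝ f (D.psiNorm i n) =
      ∑ p ∈ D.modes i n, inner ℝ (fcoeff f p.1 p.2) (fcoeff (D.psiNorm i n) p.1 p.2) := by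
  rw [modes, Finset.sum_product]
  refine (hasSum_inner_fcoeff f (D.psiNorm i n)).unique
    (hasSum_sum_of_ne_finset_zero fun k hk => Finset.sum_eq_zero fun j _ => ?_)
  rw [D.fcoeff_psiNorm_eq_zero (D.mem_freq.not.1 hk), inner_zero_right]

lemma norm_localize_sq (f : L2T) (i : Fin m) (n : ℤ) :
    ‖D.localize i n f‖ ^ 2 = ∑ p ∈ D.modes i n, ‖fcoeff f p.1 p.2‖ ^ 2 := by
  classical
  rw [modes, Finset.sum_product]
  have h : HasSum (fun k => ∑ j, ‖fcoeff (D.localize i n f) k j‖ ^ 2)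
      (∑ k ∈ D.freq i n, ∑ j, ‖fcoeff (D.localize i n f) k j‖ ^ 2) :=
    hasSum_sum_of_ne_finset_zero fun k hk => Finset.sum_eq_zero fun j _ => by
      rw [fcoeff_localize, if_neg (D.mem_freq.not.1 hk), norm_zero, zero_pow two_ne_zero]
  rw [(hasSum_norm_fcoeff_sq _).unique h]
  refine Finset.sum_congr rfl fun k hk => Finset.sum_congr rfl fun j _ => ?_
  rw [fcoeff_localize, if_pos (D.mem_freq.1 hk)]

lemma norm_psiNorm_sq (i : Fin m) (n : ℤ) :
    ‖D.psiNorm i n‖ ^ 2 = ∑ p ∈ D.modes i n, ‖fcoeff (D.psiNorm i n) p.1 p.2‖ ^ 2 := by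
  rw [← real_inner_self_eq_norm_sq, inner_psiNorm_eq_sum]
  simp only [real_inner_self_eq_norm_sq]

lemma abs_sum_mul_inner_le {ι : Type*} (s : Finset ι) {c : ι → ℝ} {W : ℝ} (hW : 0 ≤ W)
    (hc : ∀ p ∈ s, |c p| ≤ W) (z w : ι → ℂ) :
    |∑ p ∈ s, c p * inner ℝ (z p) (w p)| ≤
      W * (√(∑ p ∈ s, ‖z p‖ ^ 2) * √(∑ p ∈ s, ‖w p‖ ^ 2)) := by
  calc |∑ p ∈ s, c p * inner ℝ (z p) (w p)|
      ≤ ∑ p ∈ s, |c p * inner ℝ (z p) (w p)| := Finset.abs_sum_le_sum_abs _ _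
    _ ≤ ∑ p ∈ s, W * (‖z p‖ * ‖w p‖) := by
        refine Finset.sum_le_sum fun p hp => ?_
        rw [abs_mul]
        exact mul_le_mul (hc p hp) (abs_real_inner_le_norm _ _) (abs_nonneg _) hW
    _ = W * ∑ p ∈ s, ‖z p‖ * ‖w p‖ := by rw [Finset.mul_sum]
    _ ≤ _ := mul_le_mul_of_nonneg_left (Real.sum_mul_le_sqrt_mul_sqrt s _ _) hW

lemma abs_sum_mul_inner_psiNorm_le (f : L2T) (i : Fin m) (n : ℤ) {c : (Fin 3 → ℤ) × Fin 3 → ℝ}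
    {W : ℝ} (hW : 0 ≤ W) (hc : ∀ p ∈ D.modes i n, |c p| ≤ W) :
    |∑ p ∈ D.modes i n, c p * inner ℝ (fcoeff f p.1 p.2) (fcoeff (D.psiNorm i n) p.1 p.2)| ≤
      W * ‖D.localize i n f‖ := by
  refine (abs_sum_mul_inner_le _ hW hc _ _).trans (mul_le_mul_of_nonneg_left ?_ hW)
  rw [← norm_localize_sq, ← norm_psiNorm_sq, Real.sqrt_sq (norm_nonneg _),
    Real.sqrt_sq (norm_nonneg _)]
  exact mul_le_of_le_one_right (norm_nonneg _) (D.norm_psiNorm_le i n)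

lemma abs_inner_psiNorm_le (f : L2T) (i : Fin m) (n : ℤ) :
    |inner ℝ f (D.psiNorm i n)| ≤ ‖D.localize i n f‖ := by
  have h := D.abs_sum_mul_inner_psiNorm_le f i n (c := fun _ => 1) zero_le_one (by simp)
  simpa only [one_mul, ← inner_psiNorm_eq_sum] using h

lemma norm_localize_le (f : L2T) (i : Fin m) (n : ℤ) : ‖D.localize i n f‖ ≤ ‖f‖ := by
  refine le_of_sq_le_sq ?_ (norm_nonneg f)
  rw [norm_localize_sq, modes, Finset.sum_product]
  exact sum_le_hasSum _ (fun k _ => by positivity) (hasSum_norm_fcoeff_sq f)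

lemma zpow_mul_norm_localize_le {f : L2T} (hf : Summable (sobolevTerm 10 f)) (i : Fin m) (n : ℤ) :
    (1 + ε₀) ^ (10 * n) * ‖D.localize i n f‖ ≤ sobolevNorm 10 f := by
  refine le_of_sq_le_sq ?_ (sobolevNorm_nonneg 10 f)
  rw [mul_pow, norm_localize_sq, modes, Finset.sum_product, sobolevNorm_sq, Finset.mul_sum]
  refine le_trans (Finset.sum_le_sum fun k hk => ?_)
    (hf.sum_le_tsum (D.freq i n) fun k _ => sobolevTerm_nonneg 10 f k)
  refine mul_le_mul_of_nonneg_right ?_ (by positivity)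
  have h1 := (D.norm_of_mem_region (D.mem_freq.1 hk)).1
  have h2 : (1 + ε₀) ^ n * (1 + ε₀) ^ n ≤ 1 + 4 * Real.pi ^ 2 * ‖lat k‖ ^ 2 := by
    have := D.ratio_zpow_pos n
    have h3 := Real.pi_gt_three
    have h4 : ‖lat k‖ ^ 2 ≤ Real.pi ^ 2 * ‖lat k‖ ^ 2 :=
      le_mul_of_one_le_left (sq_nonneg _) (by nlinarith)
    nlinarith [mul_le_mul h1.le h1.le this.le (norm_nonneg _)]
  -- The squared `H¹⁰` norm weights frequencies by a 10th power of `1 + 4π²|k|²`, which is exactly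
  -- the square of the weight `(1+ε₀)^(10n)`.
  have h3 : ((1 + ε₀) ^ (10 * n)) ^ 2 = ((1 + ε₀) ^ n * (1 + ε₀) ^ n) ^ 10 := by
    rw [mul_comm 10 n, zpow_mul, zpow_ofNat]
    ring
  have h4 : (10 : ℝ) = ((10 : ℕ) : ℝ) := by norm_num
  rw [h3, h4, Real.rpow_natCast]
  exact pow_le_pow_left₀ (mul_self_nonneg _) h2 10

lemma weight_mul_norm_localize_le {f : L2T} (hf : Summable (sobolevTerm 10 f)) (i : Fin m)
    (n : ℤ) : (1 + (1 + ε₀) ^ (10 * n)) * ‖D.localize i n f‖ ≤ 2 * sobolevNorm 10 f := by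
  have h1 := D.zpow_mul_norm_localize_le hf i n
  have h2 := (D.norm_localize_le f i n).trans (norm_le_sobolevNorm (by norm_num) hf)
  linarith

lemma weight_mul_abs_inner_psiNorm_le {f : L2T} (hf : Summable (sobolevTerm 10 f)) (i : Fin m)
    (n : ℤ) : (1 + (1 + ε₀) ^ (10 * n)) * |inner ℝ f (D.psiNorm i n)| ≤ 2 * sobolevNorm 10 f := by
  refine le_trans ?_ (D.weight_mul_norm_localize_le hf i n)
  have := D.ratio_zpow_pos (10 * n)
  gcongr
  exact D.abs_inner_psiNorm_le f i n

/-! ### The cascade operator -/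

/-- Upward shifts only increase the weight, so decay at scale `n + μ` may be measured by the weight
at scale `n`. -/
lemma nonneg_of_mem_shifts {μ : ℤ × ℤ × ℤ} (hμ : μ ∈ shifts) : 0 ≤ μ.1 ∧ 0 ≤ μ.2.1 := by
  simp only [shifts, Finset.mem_insert, Finset.mem_singleton] at hμ
  rcases hμ with rfl | rfl | rfl | rfl <;> simp

lemma weight_mul_abs_inner_shift_le {f : L2T} (hf : Summable (sobolevTerm 10 f)) (i : Fin m)
    (n : ℤ) {l : ℤ} (hl : 0 ≤ l) :
    (1 + (1 + ε₀) ^ (10 * n)) * |inner ℝ f (D.psiNorm i (n + l))| ≤ 2 * sobolevNorm 10 f := by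
  refine le_trans ?_ (D.weight_mul_abs_inner_psiNorm_le hf i (n + l))
  have := D.one_lt_ratio.le
  gcongr
  linarith

lemma summable_ratio_div_weight (D : CascadeProfile ε₀ m) : Summable fun n : ℤ =>
    (1 + ε₀) ^ (5 * (n : ℝ) / 2) / (1 + (1 + ε₀) ^ (10 * n)) := by
  set b : ℝ := (1 + ε₀) ^ (5 / 2 : ℝ) with hb
  have hb1 : 1 < b := Real.one_lt_rpow D.one_lt_ratio (by norm_num)
  have hb0 : 0 < b := by linarith
  have e1 : ∀ n : ℤ, (1 + ε₀) ^ (5 * (n : ℝ) / 2) = b ^ n := fun n => by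
    rw [hb, ← Real.rpow_intCast, ← Real.rpow_mul D.ratio_pos.le]
    congr 1
    ring
  have e2 : ∀ n : ℤ, (1 + ε₀) ^ (10 * n) = (b ^ n) ^ 4 := fun n => by
    rw [← e1, ← Real.rpow_natCast, ← Real.rpow_mul D.ratio_pos.le, ← Real.rpow_intCast]
    congr 1
    push_cast
    ring
  simp only [e1, e2]
  have hg : Summable fun n : ℕ => (b ^ n)⁻¹ := by
    simp only [← inv_pow]
    exact summable_geometric_of_lt_one (by positivity) (inv_lt_one_of_one_lt₀ hb1)
  refine Summable.of_nat_of_neg ?_ ?_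
  · refine hg.of_nonneg_of_le (fun _ => by positivity) fun n => ?_
    rw [zpow_natCast, ← one_div, div_le_div_iff₀ (by positivity) (by positivity)]
    -- With `b = (1+ε₀)^(5/2)` the claim is `x² ≤ 1 + x⁴` for `x = b^n`.
    nlinarith [sq_nonneg ((b ^ n) ^ 2 - 1), sq_nonneg ((b ^ n) ^ 2 + 1)]
  · refine hg.of_nonneg_of_le (fun _ => by positivity) fun n => ?_
    rw [zpow_neg, zpow_natCast]
    exact div_le_self (by positivity) (by linarith [show 0 ≤ ((b ^ n)⁻¹) ^ 4 by positivity])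

variable (α : Fin m → Fin m → Fin m → ℤ × ℤ × ℤ → ℝ)

lemma summable_cascade {f : L2T} (hf : Summable (sobolevTerm 10 f)) :
    Summable fun n : ℤ => ∑ i₁, ∑ i₂, ∑ i₃, ∑ μ ∈ shifts,
      (α i₁ i₂ i₃ μ * (1 + ε₀) ^ (5 * (n : ℝ) / 2) * inner ℝ f (D.psiNorm i₁ (n + μ.1)) *
        inner ℝ f (D.psiNorm i₂ (n + μ.2.1))) • D.psiNorm i₃ (n + μ.2.2) := by
  refine summable_sum fun i₁ _ => summable_sum fun i₂ _ => summable_sum fun i₃ _ =>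
    summable_sum fun μ hμ => ?_
  obtain ⟨h1, h2⟩ := nonneg_of_mem_shifts hμ
  set M := 2 * sobolevNorm 10 f
  refine Summable.of_norm_bounded
    (D.summable_ratio_div_weight.mul_left (|α i₁ i₂ i₃ μ| * (M * M))) fun n => ?_
  have hr : 0 < (1 + ε₀) ^ (5 * (n : ℝ) / 2) := Real.rpow_pos_of_pos D.ratio_pos _
  have hw := D.ratio_zpow_pos (10 * n)
  have hx := D.weight_mul_abs_inner_shift_le hf i₁ n h1
  have hy := D.weight_mul_abs_inner_shift_le hf i₂ n h2
  set x := |inner ℝ f (D.psiNorm i₁ (n + μ.1))|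
  set y := |inner ℝ f (D.psiNorm i₂ (n + μ.2.1))|
  have hx0 : 0 ≤ x := abs_nonneg _
  have hy0 : 0 ≤ y := abs_nonneg _
  have hM : 0 ≤ M := le_trans (by positivity) hx
  have hy' : y ≤ M := le_trans (le_mul_of_one_le_left hy0 (by linarith)) hy
  -- One factor spends the decaying weight and the other is merely bounded; this suffices for
  -- `summable_ratio_div_weight`.
  have hxy : x * y ≤ M * M / (1 + (1 + ε₀) ^ (10 * n)) := by
    rw [le_div_iff₀ (by positivity)]
    calc x * y * (1 + (1 + ε₀) ^ (10 * n)) = ((1 + (1 + ε₀) ^ (10 * n)) * x) * y := by ring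
      _ ≤ M * M := by gcongr
  calc _ = |α i₁ i₂ i₃ μ| * (1 + ε₀) ^ (5 * (n : ℝ) / 2) * (x * y) *
        ‖D.psiNorm i₃ (n + μ.2.2)‖ := by
        rw [norm_smul, Real.norm_eq_abs, abs_mul, abs_mul, abs_mul, abs_of_pos hr]
        ring
    _ ≤ |α i₁ i₂ i₃ μ| * (1 + ε₀) ^ (5 * (n : ℝ) / 2) *
        (M * M / (1 + (1 + ε₀) ^ (10 * n))) * 1 := by
        gcongr
        exact D.norm_psiNorm_le _ _
    _ = _ := by ring

/-- On the region of `(i, n)`, the cascade operator acts as the interaction term times the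
normalized profile. -/
lemma fcoeff_cascade {f : L2T} (hf : Summable (sobolevTerm 10 f)) {i : Fin m} {n : ℤ}
    {k : Fin 3 → ℤ} (hk : lat k ∈ D.region i n) (j : Fin 3) :
    fcoeff (D.cascade α f f) k j =
      D.interaction α (fun _ => f) i n 0 • fcoeff (D.psiNorm i n) k j := by
  have h := (fcoeffL k j).hasSum (D.summable_cascade α hf).hasSum
  simp only [map_sum, map_smul, fcoeffL_apply] at h
  refine h.unique ?_
  simp only [interaction, X, Finset.sum_smul]
  refine hasSum_sum fun i₁ _ => hasSum_sum fun i₂ _ => ?_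
  have h1 : ∀ i₃, ∀ μ ∈ shifts, HasSum (fun n' : ℤ =>
      (α i₁ i₂ i₃ μ * (1 + ε₀) ^ (5 * (n' : ℝ) / 2) * inner ℝ f (D.psiNorm i₁ (n' + μ.1)) *
        inner ℝ f (D.psiNorm i₂ (n' + μ.2.1))) • fcoeff (D.psiNorm i₃ (n' + μ.2.2)) k j)
      (if i₃ = i then (α i₁ i₂ i μ * (1 + ε₀) ^ (5 * ((n - μ.2.2 : ℤ) : ℝ) / 2) *
        inner ℝ f (D.psiNorm i₁ (n - μ.2.2 + μ.1)) *
        inner ℝ f (D.psiNorm i₂ (n - μ.2.2 + μ.2.1))) • fcoeff (D.psiNorm i n) k j else 0) := by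
    intro i₃ μ _
    split_ifs with hi
    · subst hi
      -- By disjointness of the regions only the output scale `n' + μ₃ = n` contributes.
      have h2 := hasSum_single (f := fun n' : ℤ =>
        (α i₁ i₂ i₃ μ * (1 + ε₀) ^ (5 * (n' : ℝ) / 2) * inner ℝ f (D.psiNorm i₁ (n' + μ.1)) *
        inner ℝ f (D.psiNorm i₂ (n' + μ.2.1))) • fcoeff (D.psiNorm i₃ (n' + μ.2.2)) k j)
        (n - μ.2.2) fun n' hn' => by
          rw [D.fcoeff_psiNorm_eq_zero, smul_zero]
          exact fun hk' => hn' (by rw [(D.region_injective hk hk').2, add_sub_cancel_right])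
      simpa only [sub_add_cancel] using h2
    · refine hasSum_zero.congr_fun fun n' => ?_
      rw [D.fcoeff_psiNorm_eq_zero, smul_zero]
      exact fun hk' => hi (D.region_injective hk' hk).1
  have h3 := hasSum_sum (s := Finset.univ) fun i₃ _ => hasSum_sum (h1 i₃)
  rw [Finset.sum_comm] at h3
  simpa only [Finset.sum_ite_eq', Finset.mem_univ, if_true] using h3

end CascadeProfile

/-! ### Monotonicity and Gronwall on a half-line -/

lemma le_of_hasDerivWithinAt_nonpos {f f' : ℝ → ℝ} {T : ℝ} (hT : 0 ≤ T)
    (hf : ∀ t, 0 ≤ t → HasDerivWithinAt f (f' t) (Ici 0) t)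
    (hf' : ∀ t, 0 ≤ t → t ≤ T → f' t ≤ 0) : f T ≤ f 0 := by
  have h : AntitoneOn f (Icc 0 T) := by
    refine antitoneOn_of_deriv_nonpos (convex_Icc 0 T)
      (fun t ht => ((hf t ht.1).continuousWithinAt).mono Icc_subset_Ici_self) ?_ ?_
    · intro t ht
      rw [interior_Icc] at ht
      exact ((hf t ht.1.le).hasDerivAt (Ici_mem_nhds ht.1)).differentiableAt.differentiableWithinAt
    · intro t ht
      rw [interior_Icc] at ht
      rw [((hf t ht.1.le).hasDerivAt (Ici_mem_nhds ht.1)).deriv]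
      exact hf' t ht.1.le ht.2.le
  exact h ⟨le_rfl, hT⟩ ⟨hT, le_rfl⟩ hT

/-- The integrating factor makes `exp (-C t) f(t)` nonincreasing. -/
lemma nonpos_of_hasDerivWithinAt_le_mul {f f' : ℝ → ℝ} {T C : ℝ} (hT : 0 ≤ T) (h0 : f 0 = 0)
    (hf : ∀ t, 0 ≤ t → HasDerivWithinAt f (f' t) (Ici 0) t)
    (hf' : ∀ t, 0 ≤ t → t ≤ T → f' t ≤ C * f t) : f T ≤ 0 := by
  have he : ∀ t, HasDerivAt (fun t => Real.exp (-C * t)) (Real.exp (-C * t) * -C) t := fun t => by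
    simpa using ((hasDerivAt_id t).const_mul (-C)).exp
  have h := le_of_hasDerivWithinAt_nonpos (f := fun t => Real.exp (-C * t) * f t) hT
    (fun t ht => (he t).hasDerivWithinAt.mul (hf t ht)) fun t ht htT => by
      have := mul_le_mul_of_nonneg_left (hf' t ht htT) (Real.exp_nonneg (-C * t))
      linarith
  simp only [h0, mul_zero] at h
  exact nonpos_of_mul_nonpos_right h (Real.exp_pos _)

/-- The fundamental theorem of calculus for a function that is continuous on `[0,∞)`. -/
lemma hasDerivWithinAt_integral_Ici {q : ℝ → ℝ} (hq : ContinuousOn q (Ici 0)) {t : ℝ}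
    (ht : 0 ≤ t) : HasDerivWithinAt (fun t => ∫ s in (0 : ℝ)..t, q s) (q t) (Ici 0) t := by
  -- The constant extension to negative times makes the two-sided theorem applicable at `t = 0` as
  -- well.
  have hc : Continuous fun s => q (max s 0) :=
    hq.comp_continuous (by fun_prop) fun s => le_max_right s 0
  have h := (hc.integral_hasStrictDerivAt 0 t).hasDerivAt.hasDerivWithinAt (s := Ici 0)
  rw [max_eq_left ht] at h
  have e : ∀ r ∈ Ici (0 : ℝ), ∫ s in (0 : ℝ)..r, q s = ∫ s in (0 : ℝ)..r, q (max s 0) :=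
    fun r hr => intervalIntegral.integral_congr fun s hs => by
      rw [uIcc_of_le hr] at hs
      simp only [max_eq_left hs.1]
  exact h.congr e (e t ht)

namespace CascadeProfile

variable {ε₀ : ℝ} {m : ℕ} (D : CascadeProfile ε₀ m)

/-! ### Dissipation terms -/

/-- The dissipation of the coefficient `X_{i,n}`. -/
def drift (i : Fin m) (n : ℤ)
    (f : L2T) : ℝ :=
  ∑ p ∈ D.modes i n, 4 * Real.pi ^ 2 * ‖lat p.1‖ ^ 2 *
    inner ℝ (fcoeff f p.1 p.2) (fcoeff (D.psiNorm i n) p.1 p.2)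

/-- The dissipation of the energy `E_{i,n}`. -/
def dissipation (i : Fin m) (n : ℤ)
    (f : L2T) : ℝ :=
  ∑ p ∈ D.modes i n, 4 * Real.pi ^ 2 * ‖lat p.1‖ ^ 2 * ‖fcoeff f p.1 p.2‖ ^ 2

lemma dissipation_nonneg (i : Fin m)
    (n : ℤ) (f : L2T) : 0 ≤ D.dissipation i n f :=
  Finset.sum_nonneg fun p _ => by positivity

lemma abs_drift_le (i : Fin m)
    (n : ℤ) (u : ℝ → L2T) (t : ℝ) :
    |D.drift i n (u t)| ≤ 18 * Real.pi ^ 2 * ((1 + ε₀) ^ (2 * n) * √(D.E u i n t)) := by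
  have hr := D.ratio_zpow_pos n
  have h := D.abs_sum_mul_inner_psiNorm_le (u t) i n
    (c := fun p => 4 * Real.pi ^ 2 * ‖lat p.1‖ ^ 2)
    -- Here `9 = 4 · (3/2)²`, with `1 + ε₀/2 ≤ 3/2`; the passage from `18` in the claim to `9` is
    -- the crude bound `‖u_{i,n}‖ ≤ 2√E`.
    (W := 9 * Real.pi ^ 2 * (1 + ε₀) ^ (2 * n)) ?_ ?_
  · refine h.trans ?_
    have h1 : ‖D.localize i n (u t)‖ ≤ 2 * √(D.E u i n t) := by
      refine le_of_sq_le_sq ?_ (by positivity)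
      rw [mul_pow, Real.sq_sqrt (by unfold E; positivity), E]
      nlinarith [sq_nonneg ‖D.localize i n (u t)‖]
    have h2 := D.ratio_zpow_pos (2 * n)
    calc _ ≤ 9 * Real.pi ^ 2 * (1 + ε₀) ^ (2 * n) * (2 * √(D.E u i n t)) := by gcongr
      _ = _ := by ring
  · have h2 := D.ratio_zpow_pos (2 * n)
    positivity
  · intro p hp
    have h1 := (D.norm_of_mem_region (D.mem_modes.1 hp)).2
    have h2 : ‖lat p.1‖ ≤ (1 + ε₀) ^ n * (3 / 2) :=
      h1.le.trans (by gcongr; linarith [D.eps_lt_one])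
    rw [abs_of_nonneg (by positivity), mul_comm 2 n, zpow_mul, zpow_ofNat]
    calc _ ≤ 4 * Real.pi ^ 2 * ((1 + ε₀) ^ n * (3 / 2)) ^ 2 := by gcongr
      _ = _ := by ring

lemma E_nonneg (u : ℝ → L2T)
    (i : Fin m) (n : ℤ) (t : ℝ) : 0 ≤ D.E u i n t := by
  unfold E
  positivity

lemma half_X_sq_le (u : ℝ → L2T)
    (i : Fin m) (n : ℤ) (t : ℝ) : 1 / 2 * D.X u i n t ^ 2 ≤ D.E u i n t := by
  have h := D.abs_inner_psiNorm_le (u t) i n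
  rw [E, X, ← sq_abs]
  gcongr

lemma X_eq_zero {u : ℝ → L2T}
    {i : Fin m} {n : ℤ} {t : ℝ} (h : D.E u i n t = 0) : D.X u i n t = 0 := by
  have := D.half_X_sq_le u i n t
  rw [h] at this
  exact pow_eq_zero_iff two_ne_zero |>.1 (le_antisymm (by linarith) (sq_nonneg _))

namespace IsMildSolution

variable {D} {α : Fin m → Fin m → Fin m → ℤ × ℤ × ℤ → ℝ} {u₀ : L2T} {u : ℝ → L2T}

/-! ### Evolution of a mild solution -/

lemma exists_bound (hu : D.IsMildSolution α u₀ u) (T : ℝ) :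
    ∃ M, 0 ≤ M ∧ ∀ t ∈ Icc 0 T, sobolevNorm 10 (u t) ≤ M :=
  exists_sobolevNorm_le (fun t ht => (hu.mem t ht).1) hu.continuous T

lemma continuousOn (hu : D.IsMildSolution α u₀ u) : ContinuousOn u (Ici 0) := by
  intro t ht
  rw [ContinuousWithinAt, tendsto_iff_norm_sub_tendsto_zero]
  refine squeeze_zero' (Eventually.of_forall fun _ => norm_nonneg _) ?_ (hu.continuous t ht)
  filter_upwards [self_mem_nhdsWithin] with s hs
  exact norm_le_sobolevNorm (by norm_num) (summable_sobolevTerm_sub (hu.mem s hs).1 (hu.mem t ht).1)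

lemma continuousOn_X (hu : D.IsMildSolution α u₀ u) (i : Fin m) (n : ℤ) :
    ContinuousOn (D.X u i n) (Ici 0) :=
  hu.continuousOn.inner continuousOn_const

lemma continuousOn_interaction (hu : D.IsMildSolution α u₀ u) (i : Fin m) (n : ℤ) :
    ContinuousOn (D.interaction α u i n) (Ici 0) := by
  unfold interaction
  refine continuousOn_finsetSum _ fun i₁ _ => continuousOn_finsetSum _ fun i₂ _ =>
    continuousOn_finsetSum _ fun μ _ => ?_
  exact (continuousOn_const.mul (hu.continuousOn_X _ _)).mul (hu.continuousOn_X _ _)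

lemma eq_initial (hu : D.IsMildSolution α u₀ u) : u 0 = u₀ := by
  have h := hu.duhamel 0 le_rfl
  rw [intervalIntegral.integral_same, add_zero] at h
  rw [h]
  refine ext_fcoeff fun k j => ?_
  rw [fcoeff_heat le_rfl]
  simp

/-- This is Duhamel's formula at one frequency. Pulling the heat factor out leaves an integrand
independent of `t`, ready for the fundamental theorem of calculus. -/
lemma fcoeff_eq (hu : D.IsMildSolution α u₀ u) {i : Fin m} {n : ℤ} {k : Fin 3 → ℤ}
    (hk : lat k ∈ D.region i n) (j : Fin 3) {t : ℝ} (ht : 0 ≤ t) :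
    fcoeff (u t) k j = Real.exp (-(4 * Real.pi ^ 2 * ‖lat k‖ ^ 2 * t)) •
      (fcoeff u₀ k j + (∫ s in (0 : ℝ)..t, Real.exp (4 * Real.pi ^ 2 * ‖lat k‖ ^ 2 * s) *
        D.interaction α u i n s) • fcoeff (D.psiNorm i n) k j) := by
  conv_lhs => rw [hu.duhamel t ht]
  rw [fcoeff_add, fcoeff_heat ht, smul_add]
  congr 1
  rw [← fcoeffL_apply, ← ContinuousLinearMap.intervalIntegral_comp_comm _ (hu.integrable t ht),
    ← intervalIntegral.integral_smul_const, ← intervalIntegral.integral_smul]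
  refine intervalIntegral.integral_congr fun s hs => ?_
  rw [uIcc_of_le ht] at hs
  simp only [fcoeffL_apply]
  rw [fcoeff_heat (sub_nonneg.2 hs.2), D.fcoeff_cascade α (hu.mem s hs.1).1 hk, smul_smul,
    smul_smul, ← mul_assoc, ← Real.exp_add]
  have e : D.interaction α (fun _ => u s) i n 0 = D.interaction α u i n s := rfl
  rw [e]
  congr 3
  ring_nf

lemma hasDerivWithinAt_fcoeff (hu : D.IsMildSolution α u₀ u) {i : Fin m} {n : ℤ}
    {k : Fin 3 → ℤ} (hk : lat k ∈ D.region i n) (j : Fin 3) {t : ℝ} (ht : 0 ≤ t) :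
    HasDerivWithinAt (fun t => fcoeff (u t) k j)
      (-((4 * Real.pi ^ 2 * ‖lat k‖ ^ 2) • fcoeff (u t) k j) +
        D.interaction α u i n t • fcoeff (D.psiNorm i n) k j) (Ici 0) t := by
  set c := 4 * Real.pi ^ 2 * ‖lat k‖ ^ 2
  have hq : ContinuousOn (fun s => Real.exp (c * s) * D.interaction α u i n s) (Ici 0) :=
    ContinuousOn.mul (by fun_prop) (hu.continuousOn_interaction i n)
  have he : HasDerivAt (fun t => Real.exp (-(c * t))) (Real.exp (-(c * t)) * -c) t := by
    simpa using ((hasDerivAt_id t).const_mul c).neg.exp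
  have h := he.hasDerivWithinAt.smul
    (((hasDerivWithinAt_integral_Ici hq ht).smul_const (fcoeff (D.psiNorm i n) k j)).const_add
      (fcoeff u₀ k j))
  have e : ∀ t ∈ Ici (0 : ℝ), fcoeff (u t) k j = Real.exp (-(c * t)) •
      (fcoeff u₀ k j + (∫ s in (0 : ℝ)..t, Real.exp (c * s) * D.interaction α u i n s) •
        fcoeff (D.psiNorm i n) k j) := fun t ht => hu.fcoeff_eq hk j ht
  refine (h.congr e (e t ht)).congr_deriv ?_
  rw [e t ht, smul_smul, smul_smul, ← mul_assoc, ← Real.exp_add, neg_add_cancel,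
    Real.exp_zero, one_mul, add_comm, mul_neg, neg_smul,
    mul_comm c (Real.exp (-(c * t)))]

/-- The factor `‖ψ̃‖²` is 1, or 0 when the periodization vanishes, so it has to be kept here. -/
lemma hasDerivWithinAt_X (hu : D.IsMildSolution α u₀ u) (i : Fin m) (n : ℤ) {t : ℝ}
    (ht : 0 ≤ t) : HasDerivWithinAt (D.X u i n)
      (-D.drift i n (u t) + D.interaction α u i n t * ‖D.psiNorm i n‖ ^ 2) (Ici 0) t := by
  have hX : D.X u i n = fun t => ∑ p ∈ D.modes i n,
      inner ℝ (fcoeff (u t) p.1 p.2) (fcoeff (D.psiNorm i n) p.1 p.2) :=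
    funext fun t => D.inner_psiNorm_eq_sum (u t) i n
  rw [hX]
  refine (HasDerivWithinAt.fun_sum fun p hp =>
    (hu.hasDerivWithinAt_fcoeff (D.mem_modes.1 hp) p.2 ht).inner ℝ
      (hasDerivWithinAt_const t (Ici 0) (fcoeff (D.psiNorm i n) p.1 p.2))).congr_deriv ?_
  rw [norm_psiNorm_sq, drift, Finset.mul_sum, ← Finset.sum_neg_distrib, ← Finset.sum_add_distrib]
  refine Finset.sum_congr rfl fun p _ => ?_
  rw [inner_zero_right, zero_add, inner_add_left, inner_neg_left, real_inner_smul_left,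
    real_inner_smul_left, real_inner_self_eq_norm_sq]

/-- Pairing the source with `u` itself produces exactly `X`, so no factor `‖ψ̃‖²` appears. -/
lemma hasDerivWithinAt_E (hu : D.IsMildSolution α u₀ u) (i : Fin m) (n : ℤ) {t : ℝ}
    (ht : 0 ≤ t) : HasDerivWithinAt (D.E u i n)
      (-D.dissipation i n (u t) + D.interaction α u i n t * D.X u i n t) (Ici 0) t := by
  have hE : D.E u i n = fun t => 1 / 2 * ∑ p ∈ D.modes i n,
      ‖fcoeff (u t) p.1 p.2‖ ^ 2 :=
    funext fun t => by rw [E, norm_localize_sq]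
  rw [hE]
  refine ((HasDerivWithinAt.fun_sum fun p hp =>
    (hu.hasDerivWithinAt_fcoeff (D.mem_modes.1 hp) p.2 ht).norm_sq).const_mul
      (1 / 2 : ℝ)).congr_deriv ?_
  rw [X, inner_psiNorm_eq_sum, dissipation, Finset.mul_sum, Finset.mul_sum,
    ← Finset.sum_neg_distrib, ← Finset.sum_add_distrib]
  refine Finset.sum_congr rfl fun p _ => ?_
  rw [inner_add_right, inner_neg_right, real_inner_smul_right, real_inner_smul_right,
    real_inner_self_eq_norm_sq]
  ring

lemma abs_X_le (hu : D.IsMildSolution α u₀ u) {t M : ℝ} (ht : 0 ≤ t)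
    (hM : sobolevNorm 10 (u t) ≤ M) (i : Fin m) (n : ℤ) : |D.X u i n t| ≤ M :=
  (D.abs_inner_psiNorm_le _ i n).trans ((D.norm_localize_le _ i n).trans
    ((norm_le_sobolevNorm (by norm_num) (hu.mem t ht).1).trans hM))

lemma weight_mul_abs_X_le (hu : D.IsMildSolution α u₀ u) {t M : ℝ} (ht : 0 ≤ t)
    (hM : sobolevNorm 10 (u t) ≤ M) (i : Fin m) (n : ℤ) :
    (1 + (1 + ε₀) ^ (10 * n)) * |D.X u i n t| ≤ 2 * M :=
  (D.weight_mul_abs_inner_psiNorm_le (hu.mem t ht).1 i n).trans (by linarith)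

lemma weight_mul_abs_E_le (hu : D.IsMildSolution α u₀ u) {t M : ℝ} (ht : 0 ≤ t)
    (hM : sobolevNorm 10 (u t) ≤ M) (i : Fin m) (n : ℤ) :
    (1 + (1 + ε₀) ^ (10 * n)) * |D.E u i n t| ≤ M ^ 2 := by
  have h1 := (D.weight_mul_norm_localize_le (hu.mem t ht).1 i n).trans
    (mul_le_mul_of_nonneg_left hM zero_le_two)
  have h2 := (D.norm_localize_le (u t) i n).trans
    ((norm_le_sobolevNorm (by norm_num) (hu.mem t ht).1).trans hM)
  have hM0 : 0 ≤ M := (sobolevNorm_nonneg _ _).trans hM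
  rw [abs_of_nonneg (D.E_nonneg u i n t), E]
  calc _ = 1 / 2 * (((1 + (1 + ε₀) ^ (10 * n)) * ‖D.localize i n (u t)‖) *
        ‖D.localize i n (u t)‖) := by ring
    _ ≤ 1 / 2 * (2 * M * M) := by gcongr
    _ = M ^ 2 := by ring

/-- If the coefficients below scale `n` vanish, then the energy input at scale `n` is controlled
by the energy at scale `n`. -/
lemma interaction_mul_X_le (hu : D.IsMildSolution α u₀ u) {t M : ℝ} (ht : 0 ≤ t)
    (hM : sobolevNorm 10 (u t) ≤ M) {n : ℤ} (hn : ∀ i, D.X u i (n - 1) t = 0) (i : Fin m) :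
    D.interaction α u i n t * D.X u i n t ≤
      (∑ i₁, ∑ i₂, ∑ μ ∈ shifts, |α i₁ i₂ i μ| * (1 + ε₀) ^ (5 * ((n - μ.2.2 : ℤ) : ℝ) / 2) *
        (2 * M)) * ∑ i, D.E u i n t := by
  set F := ∑ i, D.E u i n t
  have hF : ∀ i, D.E u i n t ≤ F := fun i =>
    Finset.single_le_sum (f := fun i => D.E u i n t) (fun i _ => D.E_nonneg u i n t)
      (Finset.mem_univ i)
  have hM0 : 0 ≤ M := (sobolevNorm_nonneg _ _).trans hM
  have hF0 : 0 ≤ F := (D.E_nonneg u i n t).trans (hF i)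
  have h2 : ∀ i₁ n₁ i₂, |D.X u i₁ n₁ t| * (|D.X u i₂ n t| * |D.X u i n t|) ≤ 2 * M * F := by
    intro i₁ n₁ i₂
    have h1 := hu.abs_X_le ht hM i₁ n₁
    have h3 : |D.X u i₂ n t| * |D.X u i n t| ≤ 2 * F := by
      have h4 := (D.half_X_sq_le u i₂ n t).trans (hF i₂)
      have h5 := (D.half_X_sq_le u i n t).trans (hF i)
      rw [← sq_abs] at h4 h5
      nlinarith [sq_nonneg (|D.X u i₂ n t| - |D.X u i n t|)]
    calc _ ≤ M * (2 * F) := by gcongr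
      _ = _ := by ring
  -- For `μ₃ = 0` at least one factor of the quadratic term has scale `n`, and it pairs with the
  -- outer `X`; for `μ = (0,0,1)` both factors have scale `n - 1` and vanish.
  have h3 : ∀ μ ∈ shifts, ∀ i₁ i₂, |D.X u i₁ (n - μ.2.2 + μ.1) t| *
      |D.X u i₂ (n - μ.2.2 + μ.2.1) t| * |D.X u i n t| ≤ 2 * M * F := by
    intro μ hμ i₁ i₂
    simp only [shifts, Finset.mem_insert, Finset.mem_singleton] at hμ
    rcases hμ with rfl | rfl | rfl | rfl
    · simpa [mul_assoc] using h2 i₁ n i₂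
    · simpa [mul_assoc] using h2 i₁ (n + 1) i₂
    · simpa [mul_assoc, mul_left_comm] using h2 i₂ (n + 1) i₁
    · simp only [add_zero, hn, abs_zero, zero_mul]
      positivity
  simp only [interaction, Finset.sum_mul]
  refine Finset.sum_le_sum fun i₁ _ => Finset.sum_le_sum fun i₂ _ =>
    Finset.sum_le_sum fun μ hμ => (le_abs_self _).trans ?_
  have hr : 0 < (1 + ε₀) ^ (5 * ((n - μ.2.2 : ℤ) : ℝ) / 2) := Real.rpow_pos_of_pos D.ratio_pos _
  rw [abs_mul, abs_mul, abs_mul, abs_mul, abs_of_pos hr]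
  calc _ = |α i₁ i₂ i μ| * (1 + ε₀) ^ (5 * ((n - μ.2.2 : ℤ) : ℝ) / 2) *
        (|D.X u i₁ (n - μ.2.2 + μ.1) t| * |D.X u i₂ (n - μ.2.2 + μ.2.1) t| * |D.X u i n t|) := by
        ring
    _ ≤ |α i₁ i₂ i μ| * (1 + ε₀) ^ (5 * ((n - μ.2.2 : ℤ) : ℝ) / 2) * (2 * M * F) :=
        mul_le_mul_of_nonneg_left (h3 μ hμ i₁ i₂) (by positivity)
    _ = _ := by ring

/-- Energy does not spread to lower scales: if at all scales `< N` the energy vanishes initially,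
then it vanishes for all times. -/
lemma E_eq_zero (hu : D.IsMildSolution α u₀ u) {N : ℤ}
    (h0 : ∀ i, ∀ n < N, D.E u i n 0 = 0) (n : ℤ) (hn : n < N) (i : Fin m) (t : ℝ) (ht : 0 ≤ t) :
    D.E u i n t = 0 := by
  -- Scales below 0 carry no lattice frequencies, so the induction can start from `n < 0` although
  -- `n` ranges over all integers.
  suffices h : ∀ k : ℕ, ∀ n < N, n < k → ∀ i t, 0 ≤ t → D.E u i n t = 0 from
    h (n.toNat + 1) n hn (by omega) i t ht
  intro k
  induction k with
  | zero =>
    intro n _ hn i t _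
    rw [E, norm_localize_sq, modes, D.freq_eq_empty (by exact_mod_cast hn)]
    simp
  | succ k ih =>
    intro n hnN hnk i T hT
    rcases lt_or_ge n k with hlt | hge
    · exact ih n hnN hlt i T hT
    have hX : ∀ t, 0 ≤ t → ∀ i, D.X u i (n - 1) t = 0 := fun t ht i =>
      D.X_eq_zero (ih (n - 1) (by omega) (by push_cast at hnk; omega) i t ht)
    obtain ⟨M, hM0, hM⟩ := hu.exists_bound T
    -- The energies of all `i` are summed because the modes of one scale are coupled; no single one
    -- satisfies a closed inequality.
    have key := nonpos_of_hasDerivWithinAt_le_mul (f := fun t => ∑ i, D.E u i n t) hT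
      (Finset.sum_eq_zero fun i _ => h0 i n hnN)
      (fun t ht => HasDerivWithinAt.fun_sum fun i _ => hu.hasDerivWithinAt_E i n ht)
      (C := ∑ i, ∑ i₁, ∑ i₂, ∑ μ ∈ shifts,
        |α i₁ i₂ i μ| * (1 + ε₀) ^ (5 * ((n - μ.2.2 : ℤ) : ℝ) / 2) * (2 * M)) fun t ht htT => by
        rw [Finset.sum_mul]
        refine Finset.sum_le_sum fun i _ => ?_
        have h1 := hu.interaction_mul_X_le ht (hM t ⟨ht, htT⟩) (hX t ht) i
        have h2 := D.dissipation_nonneg i n (u t)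
        linarith
    exact le_antisymm ((Finset.single_le_sum (f := fun i => D.E u i n T)
      (fun i _ => D.E_nonneg u i n T) (Finset.mem_univ i)).trans key) (D.E_nonneg u i n T)

lemma interaction_eq_zero (hu : D.IsMildSolution α u₀ u) {N : ℤ}
    (h0 : ∀ i, ∀ n < N, D.E u i n 0 = 0) {n : ℤ} (hn : n < N) (i : Fin m) {t : ℝ} (ht : 0 ≤ t) :
    D.interaction α u i n t = 0 := by
  have hX : ∀ i, ∀ n < N, D.X u i n t = 0 := fun i n hn =>
    D.X_eq_zero (hu.E_eq_zero h0 n hn i t ht)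
  refine Finset.sum_eq_zero fun i₁ _ => Finset.sum_eq_zero fun i₂ _ =>
    Finset.sum_eq_zero fun μ hμ => ?_
  simp only [shifts, Finset.mem_insert, Finset.mem_singleton] at hμ
  rcases hμ with rfl | rfl | rfl | rfl
  · simp [hX i₁ n hn]
  · simp [hX i₂ n hn]
  · simp [hX i₁ n hn]
  · simp [hX i₁ (n - 1) (by omega)]

/-- The difference of the two sides is nonincreasing in time and starts at 0. The interaction
cancels since `‖ψ̃‖ = 1`, and the integral term absorbs `X · drift`. -/
lemma E_le (hu : D.IsMildSolution α u₀ u) {i : Fin m} {n : ℤ} (h1 : ‖D.psiNorm i n‖ = 1)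
    (h0 : D.E u i n 0 = 1 / 2 * D.X u i n 0 ^ 2) {T : ℝ} (hT : 0 ≤ T) :
    D.E u i n T ≤ 1 / 2 * D.X u i n T ^ 2 +
      18 * Real.pi ^ 2 * 2 * ((1 + ε₀) ^ (2 * n) * ∫ s in (0 : ℝ)..T, D.E u i n s) := by
  have hE : ContinuousOn (D.E u i n) (Ici 0) := fun t ht =>
    (hu.hasDerivWithinAt_E i n ht).continuousWithinAt
  have h := le_of_hasDerivWithinAt_nonpos hT (fun t ht =>
    ((hu.hasDerivWithinAt_E i n ht).sub
      (((hu.hasDerivWithinAt_X i n ht).pow 2).const_mul (1 / 2 : ℝ))).sub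
      ((hasDerivWithinAt_integral_Ici hE ht).const_mul
        (18 * Real.pi ^ 2 * 2 * (1 + ε₀) ^ (2 * n)))) fun t ht _ => by
    have hd := D.dissipation_nonneg i n (u t)
    have hr := D.abs_drift_le i n u t
    have hw := D.ratio_zpow_pos (2 * n)
    have hx : |D.X u i n t| ≤ 2 * √(D.E u i n t) := by
      refine le_of_sq_le_sq ?_ (by positivity)
      rw [mul_pow, Real.sq_sqrt (D.E_nonneg u i n t), sq_abs]
      nlinarith [D.half_X_sq_le u i n t, D.E_nonneg u i n t]
    have hs := Real.mul_self_sqrt (D.E_nonneg u i n t)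
    have hp : D.X u i n t * D.drift i n (u t) ≤
        18 * Real.pi ^ 2 * 2 * (1 + ε₀) ^ (2 * n) * D.E u i n t := by
      refine (le_abs_self _).trans ?_
      rw [abs_mul]
      calc _ ≤ 2 * √(D.E u i n t) *
            (18 * Real.pi ^ 2 * ((1 + ε₀) ^ (2 * n) * √(D.E u i n t))) := by gcongr
        _ = 18 * Real.pi ^ 2 * 2 * (1 + ε₀) ^ (2 * n) * (√(D.E u i n t) * √(D.E u i n t)) := by
            ring
        _ = _ := by rw [hs]
    rw [h1]
    norm_num
    linarith
  simp only [Pi.sub_apply, Pi.pow_apply, intervalIntegral.integral_same] at h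
  linarith

end IsMildSolution

/-! ### The initial datum -/

lemma inner_psiNorm_psiNorm (D : CascadeProfile ε₀ m) {i₀ : Fin m} {n₀ : ℤ}
    (h : ‖D.psiNorm i₀ n₀‖ = 1) (i : Fin m) (n : ℤ) :
    inner ℝ (D.psiNorm i₀ n₀) (D.psiNorm i n) = if i = i₀ ∧ n = n₀ then (1 : ℝ) else 0 := by
  split_ifs with hi
  · rw [hi.1, hi.2, real_inner_self_eq_norm_sq, h, one_pow]
  · rw [inner_psiNorm_eq_sum]
    refine Finset.sum_eq_zero fun p hp => ?_
    rw [D.fcoeff_psiNorm_eq_zero (fun hp' => hi (D.region_injective (D.mem_modes.1 hp) hp')),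
      inner_zero_left]

lemma norm_localize_psiNorm_sq (D : CascadeProfile ε₀ m) {i₀ : Fin m} {n₀ : ℤ}
    (h : ‖D.psiNorm i₀ n₀‖ = 1) (i : Fin m) (n : ℤ) :
    ‖D.localize i n (D.psiNorm i₀ n₀)‖ ^ 2 = if i = i₀ ∧ n = n₀ then (1 : ℝ) else 0 := by
  rw [norm_localize_sq]
  split_ifs with hi
  · rw [hi.1, hi.2, ← norm_psiNorm_sq, h, one_pow]
  · refine Finset.sum_eq_zero fun p hp => ?_
    rw [D.fcoeff_psiNorm_eq_zero (fun hp' => hi (D.region_injective (D.mem_modes.1 hp) hp')),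
      norm_zero, zero_pow two_ne_zero]

end CascadeProfile

end CascadeTorus

end

/-! ### Assembly of the five assertions -/

theorem mainTheorem4 :
    -- `K` is the absolute implied constant of the `O`-terms
    ∃ K : ℝ, 0 < K ∧
    ∀ (ε₀ : ℝ) (m : ℕ) [NeZero m] (D : CascadeTorus.CascadeProfile ε₀ m),
    -- `n₀ ≥ N` is the meaning of `n₀` sufficiently large
    ∃ N : ℕ, (∀ (i : Fin m) (n : ℤ), (N : ℤ) ≤ n → D.psiPer i n ≠ 0) ∧
    ∀ (α : Fin m → Fin m → Fin m → ℤ × ℤ × ℤ → ℝ) (n₀ : ℕ), N ≤ n₀ →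
    ∀ u : ℝ → CascadeTorus.L2T, D.IsMildSolution α (D.psiNorm 0 (n₀ : ℤ)) u →
    -- (1) weighted boundedness
    (∀ T : ℝ, 0 < T → ∃ M : ℝ, ∀ t ∈ Set.Icc (0 : ℝ) T, ∀ (n : ℤ) (i : Fin m),
      (1 + (1 + ε₀) ^ (10 * n)) * |D.X u i n t| ≤ M) ∧
    (∀ T : ℝ, 0 < T → ∃ M : ℝ, ∀ t ∈ Set.Icc (0 : ℝ) T, ∀ (n : ℤ) (i : Fin m),
      (1 + (1 + ε₀) ^ (10 * n)) * |D.E u i n t| ≤ M) ∧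
    -- (2) initial values
    (∀ (n : ℤ) (i : Fin m),
      D.E u i n 0 = 1 / 2 * D.X u i n 0 ^ 2 ∧
      D.X u i n 0 = if i = 0 ∧ n = (n₀ : ℤ) then 1 else 0) ∧
    -- (3) evolution of the coefficients and of the energies
    (∀ (n : ℤ) (i : Fin m) (t : ℝ), 0 ≤ t →
      (∃ X' : ℝ, HasDerivWithinAt (D.X u i n) X' (Set.Ici 0) t ∧
        |X' - D.interaction α u i n t| ≤ K * ((1 + ε₀) ^ (2 * n) * √(D.E u i n t))) ∧
      (∃ E' : ℝ, HasDerivWithinAt (D.E u i n) E' (Set.Ici 0) t ∧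
        E' ≤ D.interaction α u i n t * D.X u i n t)) ∧
    -- (4) energy comparison
    (∀ (n : ℤ) (i : Fin m) (t : ℝ), 0 ≤ t →
      1 / 2 * D.X u i n t ^ 2 ≤ D.E u i n t ∧
      D.E u i n t ≤ 1 / 2 * D.X u i n t ^ 2 +
        K * ((1 + ε₀) ^ (2 * n) * ∫ s in (0 : ℝ)..t, D.E u i n s)) ∧
    -- (5) vanishing below the initial scale
    (∀ (n : ℤ) (i : Fin m) (t : ℝ), n < (n₀ : ℤ) → 0 ≤ t →
      D.X u i n t = 0 ∧ D.E u i n t = 0) := by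
  -- The drift bound needs `18π²`; the energy comparison doubles it through `|X| ≤ 2√E`.
  refine ⟨18 * Real.pi ^ 2 * 2, by positivity, fun ε₀ m _ D => ?_⟩
  obtain ⟨N, hN⟩ := D.exists_forall_psiPer_ne_zero
  refine ⟨N, hN, fun α n₀ hn₀ u hu => ?_⟩
  have h1 : ‖D.psiNorm 0 (n₀ : ℤ)‖ = 1 := D.norm_psiNorm (hN 0 n₀ (by exact_mod_cast hn₀))
  have hX0 : ∀ (n : ℤ) (i : Fin m), D.X u i n 0 = if i = 0 ∧ n = (n₀ : ℤ) then 1 else 0 :=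
    fun n i => by rw [CascadeTorus.CascadeProfile.X, hu.eq_initial, D.inner_psiNorm_psiNorm h1]
  have hE0 : ∀ (n : ℤ) (i : Fin m),
      D.E u i n 0 = 1 / 2 * if i = 0 ∧ n = (n₀ : ℤ) then 1 else 0 := fun n i => by
    rw [CascadeTorus.CascadeProfile.E, hu.eq_initial, D.norm_localize_psiNorm_sq h1]
  have hlow : ∀ i, ∀ n < (n₀ : ℤ), D.E u i n 0 = 0 := fun i n hn => by
    rw [hE0, if_neg fun h => hn.ne h.2, mul_zero]
  have hE0X : ∀ (n : ℤ) (i : Fin m), D.E u i n 0 = 1 / 2 * D.X u i n 0 ^ 2 := fun n i => by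
    rw [hE0, hX0]
    split_ifs <;> norm_num
  have hnorm : ∀ (n : ℤ) (i : Fin m), (n₀ : ℤ) ≤ n → ‖D.psiNorm i n‖ = 1 := fun n i hn =>
    D.norm_psiNorm (hN i n (le_trans (by exact_mod_cast hn₀) hn))
  refine ⟨fun T _ => ?_, fun T _ => ?_, fun n i => ⟨hE0X n i, hX0 n i⟩,
    fun n i t ht => ⟨?_, ?_⟩, fun n i t ht => ⟨D.half_X_sq_le u i n t, ?_⟩, fun n i t hn ht => ?_⟩
  · obtain ⟨M, -, hM⟩ := hu.exists_bound T
    exact ⟨2 * M, fun t ht n i => hu.weight_mul_abs_X_le ht.1 (hM t ht) i n⟩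
  · obtain ⟨M, -, hM⟩ := hu.exists_bound T
    exact ⟨M ^ 2, fun t ht n i => hu.weight_mul_abs_E_le ht.1 (hM t ht) i n⟩
  · refine ⟨_, hu.hasDerivWithinAt_X i n ht, ?_⟩
    -- Below `n₀` the periodization may vanish, but there the interaction is zero anyway; from `n₀ ≥
    -- N` on the profile has norm one.
    have hQ : D.interaction α u i n t * ‖D.psiNorm i n‖ ^ 2 = D.interaction α u i n t := by
      rcases lt_or_ge n (n₀ : ℤ) with hn | hn
      · rw [hu.interaction_eq_zero hlow hn i ht, zero_mul]
      · rw [hnorm n i hn, one_pow, mul_one]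
    have hw := D.ratio_zpow_pos (2 * n)
    rw [hQ, add_sub_cancel_right, abs_neg]
    refine (D.abs_drift_le i n u t).trans (mul_le_mul_of_nonneg_right ?_ (by positivity))
    linarith [sq_nonneg Real.pi]
  · exact ⟨_, hu.hasDerivWithinAt_E i n ht, by linarith [D.dissipation_nonneg i n (u t)]⟩
  · rcases lt_or_ge n (n₀ : ℤ) with hn | hn
    · rw [hu.E_eq_zero hlow n hn i t ht]
      have hw := D.ratio_zpow_pos (2 * n)
      have hI : 0 ≤ ∫ s in (0 : ℝ)..t, D.E u i n s :=
        intervalIntegral.integral_nonneg ht fun s _ => D.E_nonneg u i n s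
      positivity
    · exact hu.E_le (hnorm n i hn) (hE0X n i) ht
  · have hE := hu.E_eq_zero hlow n hn i t ht
    exact ⟨D.X_eq_zero hE, hE⟩
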